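/- \textbf{Setting.} A classical Fisher market has $n\ge 1$ agents and $m$ divisible goods, budgets $w_i>0$, capacities $\bar s_j\ge 0$, and utilities $u_i$ which, on $\mathbb R^m_{\ge 0}$, are continuous, concave, homogeneous of degree one (for example linear), and positive at some point. There are no constraints on bundles other than non-negativity and the budget. A vector $p\in\mathbb R^m$ is an equilibrium price vector, with equilibrium allocation $x=(x_1,\dots,x_n)$, if every $x_i$ maximizes $u_i$ over $\{z\in\mathbb R^m_{\ge0}: p^Tz\le w_i\}$, if $\sum_i x_{ij}=\bar s_j$ for all $j$, and if $p^Tx_i=w_i$ for all $i$. Given a step size $\beta>0$ and arbitrary initial prices $p^{(0)}\in\mathbb R^m$ and baseline demands $y^{(0)}\in\mathbb R^{n\times m}$, the ADMM algorithm computes, for $k=0,1,2,\dots$, \[x_i^{(k+1)}=\arg\max_{z\in\mathbb R^m_{\ge 0}}\Big\{w_i\log u_i(z)-\sum_j p^{(k)}_jz_j-\tfrac\beta2\sum_j(z_j-y^{(k)}_{ij})^2\Big\}\quad\text{for all } i,\] \[y^{(k+1)}=\arg\max_{y\in\mathbb R^{n\times m}}\Big\{-\tfrac\beta2\sum_{i,j}(x^{(k+1)}_{ij}-y_{ij})^2-\tfrac\beta2\sum_j\Big(\sum_iy_{ij}-\bar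 s_j\Big)^2\Big\},\] \[p^{(k+1)}=p^{(k)}+\beta\Big(\sum_iy_i^{(k+1)}-\bar s\Big),\] where $\log v=-\infty$ for $v\le 0$. Let $W(x)=\sum_iw_i\log u_i(x_i)$, let $L(x,p)=W(x)-\sum_jp_j(\sum_ix_{ij}-\bar s_j)$, let $D(p)=\sup_{x}L(x,p)\in(-\infty,\infty]$, the supremum being over all non-negative allocations $x$ with $u_i(x_i)>0$ for all $i$ (the Lagrangian and the dual objective of the Eisenberg--Gale program), and let $\bar p^{K}=\frac1K\sum_{k=1}^Kp^{(k)}$ and $\bar x^{K}=\frac1K\sum_{k=1}^Kx^{(k)}$. \textbf{Corollary (Convergence of ADMM for classical Fisher markets).} Let $\beta>0$ be any constant; in particular, $\beta$ need not depend on the utilities. (1) For all $p^{(0)}$ and $y^{(0)}$ all maximizers in the algorithm exist and are unique, so that the iterates are well defined. (2) If all $\bar s_j>0$ and all $u_i\ge 0$ on $\mathbb R^m_{\ge 0}$, then an equilibrium price vector exists. (3) If an equilibrium price vector exists, then for all $p^{(0)}$ and $y^{(0)}$ there are an equilibrium price vector $p^*$ and a corresponding equilibrium allocation $x^*$ such that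 $p^{(k)}\to p^*$, $x^{(k)}\to x^*$ and $y^{(k)}\to x^*$, with rate $O(1/k)$ in the usual (primal-dual) sense for ADMM: (a) there is a constant $C$ such that, for all $K\ge1$, $|\sum_i\bar x^{K}_{ij}-\bar s_j|\le C/K$ for every good $j$, and $|W(\bar x^{K})-W(x^*)|\le C/K$; (b) for every $R$ there is a constant $C$ such that $L(z,\bar p^{K})-L(\bar x^{K},q)\le C/K$ for all $K\ge 1$, all non-negative allocations $z$ with entries at most $R$ and $u_i(z_i)>0$ for all $i$, and all $q\in\mathbb R^m$ with entries at most $R$ in absolute value; (c) if $p^*_j>0$ for all $j$, then there is a constant $C$ such that $D(\bar p^{K})\le D(p^*)+C/K$ for all sufficiently large $K$; (d) there is a constant $C$ such that $(p^{(k)}_j-p^{(k-1)}_j)^2\le C/k$ and $(\sum_ix^{(k)}_{ij}-\bar s_j)^2\le C/k$ for all $k\ge1$ and every good $j$. -/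

import Mathlib

open Filter Topology

noncomputable section

/-- The data of a Fisher market with `n` agents and `m` divisible goods: budgets `w i`,
capacities `s j` and utilities `u i`. Only the values of `u i` on the nonnegative orthant matter. -/
structure FisherMarket (n m : ℕ) where
  budget : Fin n → ℝ
  capacity : Fin m → ℝ
  utility : Fin n → (Fin m → ℝ) → ℝ

namespace FisherMarket

variable {n m : ℕ}

/-- The consumption set of an agent without extra linear constraints: the nonnegative orthant. -/
def orthant (m : ℕ) : Set (Fin m → ℝ) := {z | ∀ j, 0 ≤ z j}

/-- Classical Fisher market: positive budgets, nonnegative capacities, and utilities that on the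
nonnegative orthant are continuous, concave, homogeneous of degree one and positive somewhere. -/
structure IsClassical (M : FisherMarket n m) : Prop where
  budget_pos : ∀ i, 0 < M.budget i
  capacity_nonneg : ∀ j, 0 ≤ M.capacity j
  continuous : ∀ i, ContinuousOn (M.utility i) (orthant m)
  concave : ∀ i, ConcaveOn ℝ (orthant m) (M.utility i)
  homogeneous : ∀ i, ∀ z ∈ orthant m, ∀ t : ℝ, 0 < t → M.utility i (t • z) = t * M.utility i z
  exists_pos : ∀ i, ∃ z ∈ orthant m, 0 < M.utility i z

/-- The cost of the bundle `z` at the prices `p`. -/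
def cost (p z : Fin m → ℝ) : ℝ := ∑ j, p j * z j

/-- `z` is an optimal solution of the problem of agent `i` at prices `p`: it maximizes the utility
over the nonnegative bundles of cost at most the budget. -/
def IsDemand (M : FisherMarket n m) (p : Fin m → ℝ) (i : Fin n) (z : Fin m → ℝ) : Prop :=
  (z ∈ orthant m ∧ cost p z ≤ M.budget i) ∧
    ∀ z' ∈ orthant m, cost p z' ≤ M.budget i → M.utility i z' ≤ M.utility i z

/-- The prices `p` and the allocation `x` form a market equilibrium: all agents receive optimal
bundles, all goods are sold to capacity, and all budgets are used completely. -/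
structure IsEquilibrium (M : FisherMarket n m) (p : Fin m → ℝ) (x : Fin n → Fin m → ℝ) : Prop where
  optimal : ∀ i, M.IsDemand p i (x i)
  clears : ∀ j, ∑ i, x i j = M.capacity j
  budget_used : ∀ i, cost p (x i) = M.budget i

/-- `p` is an equilibrium price vector. -/
def IsEquilibriumPrice (M : FisherMarket n m) (p : Fin m → ℝ) : Prop :=
  ∃ x, M.IsEquilibrium p x

/-- The nonnegative bundles at which `log (u i)` is finite. Everywhere else in the orthant the
logarithm of the utility is `-∞`, so such bundles never maximize an objective with that term. -/
def logDomain (M : FisherMarket n m) (i : Fin n) : Set (Fin m → ℝ) :=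
  {z | z ∈ orthant m ∧ 0 < M.utility i z}

/-- The allocations at which every agent's logarithmic utility is finite. -/
def allocations (M : FisherMarket n m) : Set (Fin n → Fin m → ℝ) :=
  {x | ∀ i, x i ∈ M.logDomain i}

/-! ### The algorithm -/

/-- The regularized objective of agent `i` at prices `p` and baseline demand `b`. -/
def agentObjective (M : FisherMarket n m) (β : ℝ) (p b : Fin m → ℝ) (i : Fin n)
    (z : Fin m → ℝ) : ℝ :=
  M.budget i * Real.log (M.utility i z) - cost p z - β / 2 * ∑ j, (z j - b j) ^ 2

/-- The objective in the update of the baseline demands, given the agents' demands `x`. -/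
def baselineObjective (M : FisherMarket n m) (β : ℝ) (x y : Fin n → Fin m → ℝ) : ℝ :=
  -(β / 2 * ∑ i, ∑ j, (x i j - y i j) ^ 2) - β / 2 * ∑ j, (∑ i, y i j - M.capacity j) ^ 2

/-- The sequences `p` (prices), `x` (demands) and `y` (baseline demands) are produced by the
alternating direction method of multipliers with step size `β`. The algorithm is
started from `p 0` and `y 0`; the value `x 0` plays no role. -/
structure IsADMM (M : FisherMarket n m) (β : ℝ) (p : ℕ → Fin m → ℝ)
    (x y : ℕ → Fin n → Fin m → ℝ) : Prop where
  demand_mem : ∀ k i, x (k + 1) i ∈ M.logDomain i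
  demand_max : ∀ k i, IsMaxOn (M.agentObjective β (p k) (y k i) i) (M.logDomain i) (x (k + 1) i)
  baseline_max : ∀ k, IsMaxOn (M.baselineObjective β (x (k + 1))) Set.univ (y (k + 1))
  price_update : ∀ k j, p (k + 1) j = p k j + β * (∑ i, y (k + 1) i j - M.capacity j)

/-! ### The social problem and its dual -/

/-- The Eisenberg–Gale objective. -/
def welfare (M : FisherMarket n m) (x : Fin n → Fin m → ℝ) : ℝ :=
  ∑ i, M.budget i * Real.log (M.utility i (x i))

/-- The Lagrangian of the Eisenberg–Gale program, with the prices as multipliers of the capacity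
constraints. -/
def lagrangian (M : FisherMarket n m) (x : Fin n → Fin m → ℝ) (p : Fin m → ℝ) : ℝ :=
  M.welfare x - ∑ j, p j * (∑ i, x i j - M.capacity j)

/-- The dual objective of the Eisenberg–Gale program (possibly `+∞`); over all price vectors it is
smallest exactly at the optimal multipliers of the capacity constraints. -/
def dualObjective (M : FisherMarket n m) (p : Fin m → ℝ) : EReal :=
  ⨆ x ∈ M.allocations, ((M.lagrangian x p : ℝ) : EReal)

/-- The average of the iterates number `1, …, K` of a sequence. -/
def average {V : Type*} [AddCommGroup V] [Module ℝ V] (v : ℕ → V) (K : ℕ) : V :=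
  (1 / (K : ℝ)) • ∑ k ∈ Finset.Icc 1 K, v k

end FisherMarket

end

/-! By homogeneity, market equilibria are exactly the saddle points of the Eisenberg–Gale Lagrangian
(`IsSaddlePoint.isEquilibrium`, `IsEquilibrium.isSaddlePoint`), so it suffices to analyse ADMM on a
concave program.

Write `r` for the excess of the baseline demands. The baseline update has a closed form, which gives
`x = y + r`, and the excess of `x` is `(n + 1) r`. The optimality condition of the agents then
involves the new prices and the baseline step only. Completing squares yields `lagrangian_sub_le`:
for every allocation `z` and price vector `q`, the primal-dual gap of an iterate is at most the
decrease of a weighted squared distance to `(q, z)`, minus the squared length of the step.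

Everything else follows from this inequality. At a saddle point the gap is nonnegative, so the
distance decreases and the squared steps are summable. A cluster point is again a saddle point, and
the distance to it is monotone with a subsequence tending to zero, so the whole sequence converges
(`exists_tendsto_isSaddlePoint`). Summing over iterations and applying Jensen's inequality gives the
rates for averages (`gap_average_le`). The steps also shrink monotonically (`stepEnergy_succ_le`),
which gives the rate for the iterates themselves.

Existence of equilibrium prices is separate: a welfare maximizer exists by compactness, and Slater's
condition with a separating hyperplane provides multipliers. -/

namespace FisherMarket

variable {n m : ℕ} {M : FisherMarket n m} {β : ℝ}

/-! ### Costs -/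

lemma cost_smul (p z : Fin m → ℝ) (t : ℝ) : cost p (t • z) = t * cost p z := by
  simp only [cost, Finset.mul_sum, Pi.smul_apply, smul_eq_mul]
  exact Finset.sum_congr rfl fun j _ => by ring

lemma abs_cost_le (p z : Fin m → ℝ) : |cost p z| ≤ (∑ j, |p j|) * ‖z‖ := by
  unfold cost
  refine (Finset.abs_sum_le_sum_abs _ _).trans ?_
  rw [Finset.sum_mul]
  refine Finset.sum_le_sum fun j _ => ?_
  rw [abs_mul]
  exact mul_le_mul_of_nonneg_left (norm_le_pi_norm z j) (abs_nonneg _)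

lemma continuous_cost (p : Fin m → ℝ) : Continuous (cost p) := by
  unfold cost; fun_prop

/-! ### The orthant and the domain of the logarithmic utility -/

lemma isClosed_orthant : IsClosed (orthant m) := by
  have : orthant m = ⋂ j, {z : Fin m → ℝ | 0 ≤ z j} := by ext; simp [orthant]
  rw [this]
  exact isClosed_iInter fun j => isClosed_le continuous_const (continuous_apply j)

lemma smul_mem_orthant {z : Fin m → ℝ} (hz : z ∈ orthant m) {t : ℝ} (ht : 0 ≤ t) :
    t • z ∈ orthant m := fun j => mul_nonneg ht (hz j)

lemma add_mem_orthant {z z' : Fin m → ℝ} (hz : z ∈ orthant m) (hz' : z' ∈ orthant m) :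
    z + z' ∈ orthant m := fun j => add_nonneg (hz j) (hz' j)

namespace IsClassical

lemma utility_zero (hM : M.IsClassical) (i : Fin n) : M.utility i 0 = 0 := by
  have h := hM.homogeneous i 0 (fun j => le_rfl) 2 two_pos
  rw [smul_zero] at h
  linarith

lemma smul_mem_logDomain (hM : M.IsClassical) {i : Fin n} {z : Fin m → ℝ}
    (hz : z ∈ M.logDomain i) {t : ℝ} (ht : 0 < t) : t • z ∈ M.logDomain i := by
  refine ⟨smul_mem_orthant hz.1 ht.le, ?_⟩
  rw [hM.homogeneous i z hz.1 t ht]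
  exact mul_pos ht hz.2

lemma log_utility_smul (hM : M.IsClassical) {i : Fin n} {z : Fin m → ℝ}
    (hz : z ∈ M.logDomain i) {t : ℝ} (ht : 0 < t) :
    Real.log (M.utility i (t • z)) = Real.log t + Real.log (M.utility i z) := by
  rw [hM.homogeneous i z hz.1 t ht, Real.log_mul ht.ne' hz.2.ne']

lemma concaveOn_log_utility (hM : M.IsClassical) (i : Fin n) :
    ConcaveOn ℝ (M.logDomain i) fun z => Real.log (M.utility i z) := by
  have key : ∀ z ∈ M.logDomain i, ∀ z' ∈ M.logDomain i, ∀ a b : ℝ, 0 ≤ a → 0 ≤ b → a + b = 1 →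
      0 < a * M.utility i z + b * M.utility i z' := by
    intro z hz z' hz' a b ha hb hab
    rcases ha.eq_or_lt with rfl | ha
    · have : b = 1 := by linarith
      subst this
      simpa using hz'.2
    · have := mul_pos ha hz.2
      have := mul_nonneg hb hz'.2.le
      linarith
  refine ⟨?_, ?_⟩
  · intro z hz z' hz' a b ha hb hab
    refine ⟨(hM.concave i).1 hz.1 hz'.1 ha hb hab, ?_⟩
    exact (key z hz z' hz' a b ha hb hab).trans_le ((hM.concave i).2 hz.1 hz'.1 ha hb hab)
  · intro z hz z' hz' a b ha hb hab
    have h1 := strictConcaveOn_log_Ioi.concaveOn.2 (Set.mem_Ioi.2 hz.2) (Set.mem_Ioi.2 hz'.2)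
      ha hb hab
    exact h1.trans (Real.log_le_log (key z hz z' hz' a b ha hb hab)
      ((hM.concave i).2 hz.1 hz'.1 ha hb hab))

lemma concaveOn_weighted_log_utility (hM : M.IsClassical) (i : Fin n) :
    ConcaveOn ℝ (M.logDomain i) fun z => M.budget i * Real.log (M.utility i z) :=
  (hM.concaveOn_log_utility i).smul (hM.budget_pos i).le

/-- The utility grows at most linearly on the orthant. -/
lemma exists_utility_le (hM : M.IsClassical) (i : Fin n) :
    ∃ C, 0 ≤ C ∧ ∀ z ∈ orthant m, M.utility i z ≤ C * ‖z‖ := by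
  have hcomp : IsCompact (orthant m ∩ Metric.closedBall 0 1) :=
    (isCompact_closedBall 0 1).inter_left isClosed_orthant
  obtain ⟨C, hC⟩ := (hcomp.image_of_continuousOn
    ((hM.continuous i).mono Set.inter_subset_left)).bddAbove
  have hC' : ∀ z ∈ orthant m, ‖z‖ ≤ 1 → M.utility i z ≤ C := fun z hz h =>
    hC ⟨z, ⟨hz, by simpa using h⟩, rfl⟩
  have hC0 : 0 ≤ C := by
    rw [← hM.utility_zero i]
    exact hC' 0 (fun j => le_rfl) (by simp)
  refine ⟨C, hC0, fun z hz => ?_⟩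
  rcases eq_or_ne z 0 with rfl | h0
  · simp [hM.utility_zero i]
  have hpos : 0 < ‖z‖ := norm_pos_iff.2 h0
  have h := hC' (‖z‖⁻¹ • z) (smul_mem_orthant hz (inv_nonneg.2 hpos.le))
    (by rw [norm_smul, norm_inv, norm_norm, inv_mul_cancel₀ hpos.ne'])
  rw [hM.homogeneous i z hz _ (inv_pos.2 hpos), inv_mul_le_iff₀ hpos] at h
  linarith

lemma nonempty_logDomain (hM : M.IsClassical) (i : Fin n) : (M.logDomain i).Nonempty := by
  obtain ⟨z, hz, hu⟩ := hM.exists_pos i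
  exact ⟨z, hz, hu⟩

/-! ### The problem of an agent in the algorithm -/

/-- The objective of an agent is coercive: it can be bounded below by a given constant only on a
bounded set on which the utility is bounded away from zero. -/
lemma agentObjective_coercive (hM : M.IsClassical) (hβ : 0 < β) (p b : Fin m → ℝ) (i : Fin n)
    (c : ℝ) : ∃ R ε : ℝ, 0 < ε ∧ ∀ z ∈ M.logDomain i, c ≤ M.agentObjective β p b i z →
      ‖z‖ ≤ R ∧ ε ≤ M.utility i z := by
  obtain ⟨C, hC0, hC⟩ := hM.exists_utility_le i
  have hw := hM.budget_pos i
  obtain ⟨P, hPdef⟩ : ∃ P, P = ∑ j, |p j| := ⟨_, rfl⟩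
  have hP : 0 ≤ P := hPdef ▸ Finset.sum_nonneg fun j _ => abs_nonneg _
  obtain ⟨A, hA⟩ : ∃ A, A = M.budget i * C + P := ⟨_, rfl⟩
  obtain ⟨Q, hQ⟩ : ∃ Q, Q = 4 / β * (A ^ 2 / β + A * ‖b‖ - c) := ⟨_, rfl⟩
  -- `A` bounds the linear growth of the logarithm and the cost together. Absorbing it into half of
  -- the quadratic penalty leaves `(‖z‖ - ‖b‖) ^ 2 ≤ Q`. The lower bound on the utility is then read
  -- off from the logarithm.
  refine ⟨‖b‖ + Q + 1, Real.exp ((c - P * (‖b‖ + Q + 1)) / M.budget i), Real.exp_pos _, ?_⟩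
  intro z hz hobj
  have hcost := abs_cost_le p z
  rw [← hPdef] at hcost
  have hcost' := (abs_le.1 hcost).1
  have hlog : M.budget i * Real.log (M.utility i z) ≤ M.budget i * C * ‖z‖ := by
    rw [mul_assoc]
    refine mul_le_mul_of_nonneg_left ?_ hw.le
    have := Real.log_le_sub_one_of_pos hz.2
    have := hC z hz.1
    linarith
  have hsq : (‖z‖ - ‖b‖) ^ 2 ≤ ∑ j, (z j - b j) ^ 2 := by
    have h1 : |‖z‖ - ‖b‖| ≤ ‖z - b‖ := abs_norm_sub_norm_le z b
    have h2 : ‖z - b‖ ≤ Real.sqrt (∑ j, (z j - b j) ^ 2) := by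
      refine (pi_norm_le_iff_of_nonneg (Real.sqrt_nonneg _)).2 fun j => ?_
      rw [Real.norm_eq_abs]
      refine Real.abs_le_sqrt ?_
      exact Finset.single_le_sum (f := fun j => (z j - b j) ^ 2) (fun j _ => sq_nonneg _)
        (Finset.mem_univ j)
    rw [← sq_abs, ← Real.sq_sqrt (Finset.sum_nonneg fun j (_ : j ∈ Finset.univ) =>
      sq_nonneg (z j - b j))]
    exact pow_le_pow_left₀ (abs_nonneg _) (h1.trans h2) 2
  unfold agentObjective at hobj
  have hmul := mul_le_mul_of_nonneg_left hsq (by positivity : 0 ≤ β / 2)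
  have hnorm : ‖z‖ ≤ ‖b‖ + Q + 1 := by
    have hexp : (‖z‖ - ‖b‖) ^ 2 ≤ Q := by
      have e : A * (‖z‖ - ‖b‖) ≤ A ^ 2 / β + β / 4 * (‖z‖ - ‖b‖) ^ 2 := by
        have : 0 ≤ (A - β / 2 * (‖z‖ - ‖b‖)) ^ 2 / β := by positivity
        have e2 : (A - β / 2 * (‖z‖ - ‖b‖)) ^ 2 / β
          = A ^ 2 / β + β / 4 * (‖z‖ - ‖b‖) ^ 2 - A * (‖z‖ - ‖b‖) := by field_simp; ring
        linarith
      have e3 : β / 4 * (‖z‖ - ‖b‖) ^ 2 ≤ A ^ 2 / β + A * ‖b‖ - c := by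
        rw [hA] at e ⊢
        nlinarith
      rw [hQ, div_mul_eq_mul_div, le_div_iff₀ hβ]
      linarith
    nlinarith [sq_nonneg (‖z‖ - ‖b‖ - 1)]
  refine ⟨hnorm, ?_⟩
  rw [← Real.le_log_iff_exp_le hz.2, div_le_iff₀ hw]
  have h0 : 0 ≤ β / 2 * ∑ j, (z j - b j) ^ 2 :=
    mul_nonneg (by positivity) (Finset.sum_nonneg fun j _ => sq_nonneg _)
  have := mul_le_mul_of_nonneg_left hnorm hP
  linarith

lemma exists_isMaxOn_agentObjective (hM : M.IsClassical) (hβ : 0 < β) (p b : Fin m → ℝ)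
    (i : Fin n) : ∃ z ∈ M.logDomain i, IsMaxOn (M.agentObjective β p b i) (M.logDomain i) z := by
  obtain ⟨z₀, hz₀⟩ := hM.nonempty_logDomain i
  obtain ⟨R, ε, hε, hcoer⟩ := hM.agentObjective_coercive hβ p b i (M.agentObjective β p b i z₀)
  have hsub : (orthant m ∩ M.utility i ⁻¹' Set.Ici ε) ∩ Metric.closedBall 0 R ⊆ M.logDomain i :=
    fun z hz => ⟨hz.1.1, hε.trans_le hz.1.2⟩
  have hcomp : IsCompact ((orthant m ∩ M.utility i ⁻¹' Set.Ici ε) ∩ Metric.closedBall 0 R) :=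
    (isCompact_closedBall 0 R).inter_left
      ((hM.continuous i).preimage_isClosed_of_isClosed isClosed_orthant isClosed_Ici)
  have hcont : ContinuousOn (M.agentObjective β p b i)
      ((orthant m ∩ M.utility i ⁻¹' Set.Ici ε) ∩ Metric.closedBall 0 R) := by
    unfold agentObjective
    refine ((continuousOn_const.mul (ContinuousOn.log ((hM.continuous i).mono
      fun z hz => hz.1.1) fun z hz => (hsub hz).2.ne')).sub
      (continuous_cost p).continuousOn).sub ?_
    fun_prop
  have hmem : ∀ z ∈ M.logDomain i, M.agentObjective β p b i z₀ ≤ M.agentObjective β p b i z →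
      z ∈ (orthant m ∩ M.utility i ⁻¹' Set.Ici ε) ∩ Metric.closedBall 0 R := fun z hz h =>
    ⟨⟨hz.1, (hcoer z hz h).2⟩, by simpa using (hcoer z hz h).1⟩
  obtain ⟨z, hz, hmax⟩ := hcomp.exists_isMaxOn ⟨z₀, hmem z₀ hz₀ le_rfl⟩ hcont
  refine ⟨z, hsub hz, fun z' hz' => ?_⟩
  have hz₀z : M.agentObjective β p b i z₀ ≤ M.agentObjective β p b i z := hmax (hmem z₀ hz₀ le_rfl)
  rcases le_total (M.agentObjective β p b i z₀) (M.agentObjective β p b i z') with h | h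
  · exact hmax (hmem z' hz' h)
  · exact h.trans hz₀z

/-- First-order optimality condition for the problem of an agent in the algorithm. -/
lemma agentObjective_variational (hM : M.IsClassical) {p b : Fin m → ℝ} {i : Fin n}
    {x : Fin m → ℝ} (hx : x ∈ M.logDomain i)
    (hmax : IsMaxOn (M.agentObjective β p b i) (M.logDomain i) x) {z : Fin m → ℝ}
    (hz : z ∈ M.logDomain i) :
    M.budget i * Real.log (M.utility i z) - M.budget i * Real.log (M.utility i x) ≤
      ∑ j, (p j + β * (x j - b j)) * (z j - x j) := by
  -- Compare `x` with the point at parameter `t` on the segment to `z` and divide by `t`. The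
  -- remaining error is linear in `t` and vanishes in the limit.
  have key : ∀ t : ℝ, 0 < t → t ≤ 1 →
      M.budget i * Real.log (M.utility i z) - M.budget i * Real.log (M.utility i x) ≤
        ∑ j, (p j + β * (x j - b j)) * (z j - x j) + t * (β / 2 * ∑ j, (z j - x j) ^ 2) := by
    intro t ht ht1
    have hconc := (hM.concaveOn_weighted_log_utility i).2 hx hz (sub_nonneg.2 ht1) ht.le
      (by ring : 1 - t + t = 1)
    have hm := hmax ((hM.concaveOn_weighted_log_utility i).1 hx hz (sub_nonneg.2 ht1) ht.le
      (by ring : 1 - t + t = 1))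
    simp only [Set.mem_ofPred_eq, agentObjective, smul_eq_mul] at hm hconc
    have hq : cost p ((1 - t) • x + t • z) + β / 2 * ∑ j, (((1 - t) • x + t • z) j - b j) ^ 2
        = cost p x + β / 2 * ∑ j, (x j - b j) ^ 2
          + t * (∑ j, (p j + β * (x j - b j)) * (z j - x j)
            + t * (β / 2 * ∑ j, (z j - x j) ^ 2)) := by
      simp only [cost, Finset.mul_sum, ← Finset.sum_add_distrib]
      refine Finset.sum_congr rfl fun j _ => ?_
      simp only [Pi.add_apply, Pi.smul_apply, smul_eq_mul]
      ring
    refine le_of_mul_le_mul_left ?_ ht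
    linarith
  refine ge_of_tendsto (x := 𝓝[>] (0 : ℝ)) (f := fun t : ℝ =>
    ∑ j, (p j + β * (x j - b j)) * (z j - x j) + t * (β / 2 * ∑ j, (z j - x j) ^ 2)) ?_ ?_
  · refine tendsto_nhdsWithin_of_tendsto_nhds ?_
    have : Continuous fun t : ℝ =>
      ∑ j, (p j + β * (x j - b j)) * (z j - x j) + t * (β / 2 * ∑ j, (z j - x j) ^ 2) := by
      fun_prop
    simpa using this.tendsto 0
  · filter_upwards [Ioc_mem_nhdsGT (zero_lt_one' ℝ)] with t ht using key t ht.1 ht.2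

/-- Testing the optimality condition of each maximizer at the other and adding, prices and
logarithms cancel and only `0 ≤ -β ∑ (x j - x' j) ^ 2` remains. -/
lemma agentObjective_maximizer_unique (hM : M.IsClassical) (hβ : 0 < β) {p b : Fin m → ℝ}
    {i : Fin n} {x x' : Fin m → ℝ} (hx : x ∈ M.logDomain i)
    (hmax : IsMaxOn (M.agentObjective β p b i) (M.logDomain i) x) (hx' : x' ∈ M.logDomain i)
    (hmax' : IsMaxOn (M.agentObjective β p b i) (M.logDomain i) x') : x = x' := by
  have h1 := hM.agentObjective_variational hx hmax hx'
  have h2 := hM.agentObjective_variational hx' hmax' hx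
  have h3 : ∑ j, (p j + β * (x j - b j)) * (x' j - x j)
      + ∑ j, (p j + β * (x' j - b j)) * (x j - x' j) = -(β * ∑ j, (x j - x' j) ^ 2) := by
    rw [Finset.mul_sum, ← Finset.sum_add_distrib, ← Finset.sum_neg_distrib]
    exact Finset.sum_congr rfl fun j _ => by ring
  have h4 : ∑ j, (x j - x' j) ^ 2 ≤ 0 := by
    by_contra! h
    have := mul_pos hβ h
    linarith
  have h5 := (Finset.sum_eq_zero_iff_of_nonneg fun j _ => sq_nonneg (x j - x' j)).1
    (le_antisymm h4 (Finset.sum_nonneg fun j _ => sq_nonneg _))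
  funext j
  exact sub_eq_zero.1 (pow_eq_zero_iff two_ne_zero |>.1 (h5 j (Finset.mem_univ j)))

end IsClassical

/-! ### The update of the baseline demands -/

/-- The maximizer of the baseline objective. -/
noncomputable def baselineUpdate (M : FisherMarket n m) (x : Fin n → Fin m → ℝ) :
    Fin n → Fin m → ℝ :=
  fun i j => x i j - (∑ l, x l j - M.capacity j) / (n + 1)

lemma sum_baselineUpdate (x : Fin n → Fin m → ℝ) (j : Fin m) :
    ∑ i, M.baselineUpdate x i j - M.capacity j = (∑ l, x l j - M.capacity j) / (n + 1) := by
  simp only [baselineUpdate, Finset.sum_sub_distrib, Finset.sum_const, Finset.card_univ,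
    Fintype.card_fin, nsmul_eq_mul]
  have : (n : ℝ) + 1 ≠ 0 := by positivity
  field_simp
  ring

/-- Exact expansion of the quadratic objective around its critical point. Being an equality with
squares on the right, it gives maximality and uniqueness at once. -/
lemma baselineObjective_baselineUpdate_sub (x y : Fin n → Fin m → ℝ) :
    M.baselineObjective β x (M.baselineUpdate x) - M.baselineObjective β x y
      = β / 2 * (∑ i, ∑ j, (y i j - M.baselineUpdate x i j) ^ 2)
        + β / 2 * ∑ j, (∑ i, (y i j - M.baselineUpdate x i j)) ^ 2 := by
  have hs := fun j => sum_baselineUpdate (M := M) x j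
  -- This is the stationarity condition. It is all that is needed about the update, whose formula
  -- can be forgotten from here on.
  have hx : ∀ i j, x i j = M.baselineUpdate x i j + (∑ i, M.baselineUpdate x i j - M.capacity j) :=
    fun i j => by rw [hs]; simp [baselineUpdate]
  generalize M.baselineUpdate x = v at *
  have e : ∀ j, ∑ i, (x i j - y i j) ^ 2 - ∑ i, (x i j - v i j) ^ 2
      + ((∑ i, y i j - M.capacity j) ^ 2 - (∑ i, v i j - M.capacity j) ^ 2)
      = ∑ i, (y i j - v i j) ^ 2 + (∑ i, (y i j - v i j)) ^ 2 := by
    intro j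
    simp only [hx _ j]
    generalize hr : ∑ i, v i j - M.capacity j = r
    have h1 : ∀ i, (v i j + r - y i j) ^ 2 =
      (v i j + r - v i j) ^ 2 + (y i j - v i j) ^ 2 - 2 * r * (y i j - v i j) := fun i => by ring
    rw [Finset.sum_congr rfl fun i _ => h1 i, Finset.sum_sub_distrib, Finset.sum_add_distrib,
      ← Finset.mul_sum, Finset.sum_sub_distrib]
    rw [show ∑ i, y i j - M.capacity j = (∑ i, y i j - ∑ i, v i j) + r by rw [← hr]; ring]
    ring
  have e' := Finset.sum_congr rfl fun j (_ : j ∈ Finset.univ) => e j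
  simp only [Finset.sum_add_distrib, Finset.sum_sub_distrib] at e'
  unfold baselineObjective
  rw [Finset.sum_comm (f := fun i j => (x i j - y i j) ^ 2),
    Finset.sum_comm (f := fun i j => (x i j - v i j) ^ 2),
    Finset.sum_comm (f := fun i j => (y i j - v i j) ^ 2)]
  simp only [Finset.sum_sub_distrib]
  linear_combination β / 2 * e'

lemma isMaxOn_baselineObjective_iff (hβ : 0 < β) (x y : Fin n → Fin m → ℝ) :
    IsMaxOn (M.baselineObjective β x) Set.univ y ↔ y = M.baselineUpdate x := by
  constructor
  · intro h
    have h1 : M.baselineObjective β x (M.baselineUpdate x) ≤ M.baselineObjective β x y :=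
      h (Set.mem_univ _)
    have h2 := baselineObjective_baselineUpdate_sub (M := M) (β := β) x y
    have h3 : 0 ≤ β / 2 * ∑ j, (∑ i, (y i j - M.baselineUpdate x i j)) ^ 2 :=
      mul_nonneg (by positivity) (Finset.sum_nonneg fun j _ => sq_nonneg _)
    have h4 : ∑ i, ∑ j, (y i j - M.baselineUpdate x i j) ^ 2 ≤ 0 := by
      by_contra! h
      have := mul_pos (half_pos hβ) h
      linarith
    have h0 : ∀ i, 0 ≤ ∑ j, (y i j - M.baselineUpdate x i j) ^ 2 := fun i =>
      Finset.sum_nonneg fun j _ => sq_nonneg _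
    have h5 := (Finset.sum_eq_zero_iff_of_nonneg fun i _ => h0 i).1
      (le_antisymm h4 (Finset.sum_nonneg fun i _ => h0 i))
    funext i j
    have h6 := (Finset.sum_eq_zero_iff_of_nonneg fun j _ => sq_nonneg _).1
      (h5 i (Finset.mem_univ i)) j (Finset.mem_univ j)
    exact sub_eq_zero.1 (pow_eq_zero_iff two_ne_zero |>.1 h6)
  · rintro rfl y _
    have h2 := baselineObjective_baselineUpdate_sub (M := M) (β := β) x y
    have h3 : 0 ≤ β / 2 * ∑ j, (∑ i, (y i j - M.baselineUpdate x i j)) ^ 2 :=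
      mul_nonneg (by positivity) (Finset.sum_nonneg fun j _ => sq_nonneg _)
    have h4 : 0 ≤ β / 2 * ∑ i, ∑ j, (y i j - M.baselineUpdate x i j) ^ 2 :=
      mul_nonneg (by positivity)
        (Finset.sum_nonneg fun i _ => Finset.sum_nonneg fun j _ => sq_nonneg _)
    simp only [Set.mem_ofPred_eq]
    linarith

/-! ### The algorithm is well defined -/

lemma IsClassical.exists_isADMM (hM : M.IsClassical) (hβ : 0 < β) (p₀ : Fin m → ℝ)
    (y₀ : Fin n → Fin m → ℝ) : ∃ p x y, M.IsADMM β p x y ∧ p 0 = p₀ ∧ y 0 = y₀ := by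
  choose demand hmem hmax using fun p b i => hM.exists_isMaxOn_agentObjective hβ p b i
  let d : (Fin m → ℝ) × (Fin n → Fin m → ℝ) → Fin n → Fin m → ℝ :=
    fun σ i => demand σ.1 (σ.2 i) i
  let step : (Fin m → ℝ) × (Fin n → Fin m → ℝ) → (Fin m → ℝ) × (Fin n → Fin m → ℝ) := fun σ =>
    (fun j => σ.1 j + β * (∑ i, M.baselineUpdate (d σ) i j - M.capacity j), M.baselineUpdate (d σ))
  let σ : ℕ → (Fin m → ℝ) × (Fin n → Fin m → ℝ) := fun k => step^[k] (p₀, y₀)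
  have hσ : ∀ k, σ (k + 1) = step (σ k) := fun k => Function.iterate_succ_apply' step k _
  -- The demands with index `k + 1` are computed from state `k`; truncated subtraction only gives
  -- the irrelevant `x 0` some value.
  refine ⟨fun k => (σ k).1, fun k => d (σ (k - 1)), fun k => (σ k).2, ⟨?_, ?_, ?_, ?_⟩, rfl, rfl⟩
  · exact fun k i => hmem _ _ i
  · exact fun k i => hmax _ _ i
  · intro k
    rw [isMaxOn_baselineObjective_iff hβ]
    simp only [hσ, Nat.add_sub_cancel]
    rfl
  · intro k j
    simp only [hσ]
    rfl

lemma IsClassical.isADMM_unique (hM : M.IsClassical) (hβ : 0 < β) {p p' : ℕ → Fin m → ℝ}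
    {x y x' y' : ℕ → Fin n → Fin m → ℝ} (h : M.IsADMM β p x y) (h' : M.IsADMM β p' x' y')
    (hp : p 0 = p' 0) (hy : y 0 = y' 0) :
    p = p' ∧ y = y' ∧ ∀ k, x (k + 1) = x' (k + 1) := by
  have hx : ∀ k, p k = p' k → y k = y' k → x (k + 1) = x' (k + 1) := by
    intro k hpk hyk
    funext i
    refine hM.agentObjective_maximizer_unique hβ (h.demand_mem k i) (h.demand_max k i)
      (h'.demand_mem k i) ?_
    rw [hpk, hyk]
    exact h'.demand_max k i
  have hpy : ∀ k, p k = p' k ∧ y k = y' k := by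
    intro k
    induction k with
    | zero => exact ⟨hp, hy⟩
    | succ k ih =>
      have hyk : y (k + 1) = y' (k + 1) := by
        rw [(isMaxOn_baselineObjective_iff hβ _ _).1 (h.baseline_max k),
          (isMaxOn_baselineObjective_iff hβ _ _).1 (h'.baseline_max k), hx k ih.1 ih.2]
      refine ⟨?_, hyk⟩
      funext j
      rw [h.price_update, h'.price_update, hyk, ih.1]
  exact ⟨funext fun k => (hpy k).1, funext fun k => (hpy k).2,
    fun k => hx k (hpy k).1 (hpy k).2⟩

/-! ### Saddle points of the Lagrangian -/

lemma sum_mul_sum_sub_capacity (p : Fin m → ℝ) (x : Fin n → Fin m → ℝ) :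
    ∑ j, p j * (∑ i, x i j - M.capacity j) = ∑ i, cost p (x i) - cost p M.capacity := by
  simp only [cost, mul_sub, Finset.sum_sub_distrib, Finset.mul_sum]
  rw [Finset.sum_comm]

/-- A saddle point of the Lagrangian of the Eisenberg–Gale program: a feasible allocation and
prices at which it maximizes the Lagrangian. -/
structure IsSaddlePoint (M : FisherMarket n m) (p : Fin m → ℝ) (x : Fin n → Fin m → ℝ) :
    Prop where
  mem : x ∈ M.allocations
  clears : ∀ j, ∑ i, x i j = M.capacity j
  lagrangian_le : ∀ z ∈ M.allocations, M.lagrangian z p ≤ M.lagrangian x p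

lemma lagrangian_eq_welfare {x : Fin n → Fin m → ℝ} (hx : ∀ j, ∑ i, x i j = M.capacity j)
    (p : Fin m → ℝ) : M.lagrangian x p = M.welfare x := by
  simp [lagrangian, hx]

/-- The Lagrangian is separable over agents, so changing a single bundle isolates one term. -/
lemma IsSaddlePoint.agent_le {p : Fin m → ℝ} {x : Fin n → Fin m → ℝ} (h : M.IsSaddlePoint p x)
    (i : Fin n) {z : Fin m → ℝ} (hz : z ∈ M.logDomain i) :
    M.budget i * Real.log (M.utility i z) - M.budget i * Real.log (M.utility i (x i)) ≤
      cost p z - cost p (x i) := by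
  have hmem : Function.update x i z ∈ M.allocations := by
    intro l
    rcases eq_or_ne l i with rfl | hl
    · simpa using hz
    · simpa [hl] using h.mem l
  have hle := h.lagrangian_le _ hmem
  simp only [lagrangian, sum_mul_sum_sub_capacity, welfare] at hle
  have e1 := Finset.add_sum_erase Finset.univ
    (fun l => M.budget l * Real.log (M.utility l (Function.update x i z l))) (Finset.mem_univ i)
  have e2 := Finset.add_sum_erase Finset.univ
    (fun l => M.budget l * Real.log (M.utility l (x l))) (Finset.mem_univ i)
  have e3 := Finset.add_sum_erase Finset.univ
    (fun l => cost p (Function.update x i z l)) (Finset.mem_univ i)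
  have e4 := Finset.add_sum_erase Finset.univ (fun l => cost p (x l)) (Finset.mem_univ i)
  rw [Finset.sum_congr rfl fun l hl => by
    rw [Function.update_of_ne (Finset.ne_of_mem_erase hl)]] at e1 e3
  simp only [Function.update_self] at e1 e3
  linarith

/-- Scaling the bundle by `t` adds `log t` to the log-utility and multiplies the cost by `t`. Since
`t = 1` is optimal, the derivative there vanishes. -/
lemma IsSaddlePoint.cost_eq (hM : M.IsClassical) {p : Fin m → ℝ} {x : Fin n → Fin m → ℝ}
    (h : M.IsSaddlePoint p x) (i : Fin n) : cost p (x i) = M.budget i := by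
  have hw := hM.budget_pos i
  have key : ∀ t : ℝ, 0 < t → M.budget i * Real.log t ≤ (t - 1) * cost p (x i) := by
    intro t ht
    have h1 := h.agent_le i (hM.smul_mem_logDomain (h.mem i) ht)
    rw [hM.log_utility_smul (h.mem i) ht, cost_smul] at h1
    linarith
  have hd : HasDerivAt (fun t : ℝ => (t - 1) * cost p (x i) - M.budget i * Real.log t)
      (1 * cost p (x i) - M.budget i * 1⁻¹) 1 :=
    (((hasDerivAt_id (1 : ℝ)).sub_const 1).mul_const _).sub
      ((Real.hasDerivAt_log one_ne_zero).const_mul _)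
  have hmin : IsLocalMin (fun t : ℝ => (t - 1) * cost p (x i) - M.budget i * Real.log t) 1 := by
    filter_upwards [lt_mem_nhds (zero_lt_one' ℝ)] with t ht
    have := key t ht
    simp only [sub_self, zero_mul, Real.log_one, mul_zero]
    linarith
  have := hmin.hasDerivAt_eq_zero hd
  simp only [one_mul, inv_one, mul_one] at this
  linarith

lemma IsSaddlePoint.isEquilibrium (hM : M.IsClassical) {p : Fin m → ℝ} {x : Fin n → Fin m → ℝ}
    (h : M.IsSaddlePoint p x) : M.IsEquilibrium p x := by
  refine ⟨fun i => ⟨⟨(h.mem i).1, (h.cost_eq hM i).le⟩, fun z hz hcost => ?_⟩, h.clears,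
    h.cost_eq hM⟩
  by_contra! hlt
  have h1 := h.agent_le i (z := z) ⟨hz, (h.mem i).2.trans hlt⟩
  have h2 := mul_lt_mul_of_pos_left (Real.log_lt_log (h.mem i).2 hlt) (hM.budget_pos i)
  rw [h.cost_eq hM i] at h1
  linarith

lemma IsDemand.mem_logDomain (hM : M.IsClassical) {p : Fin m → ℝ} {i : Fin n} {x : Fin m → ℝ}
    (h : M.IsDemand p i x) : x ∈ M.logDomain i := by
  refine ⟨h.1.1, ?_⟩
  obtain ⟨z, hz⟩ := hM.nonempty_logDomain i
  have hw := hM.budget_pos i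
  -- A small enough multiple of a bundle of positive utility is affordable. Prices may be negative,
  -- hence the absolute value.
  have ht : 0 < M.budget i / (|cost p z| + 1) := by positivity
  have hmem := hM.smul_mem_logDomain hz ht
  refine hmem.2.trans_le (h.2 _ hmem.1 ?_)
  rw [cost_smul, div_mul_eq_mul_div, div_le_iff₀ (by positivity)]
  exact mul_le_mul_of_nonneg_left ((le_abs_self _).trans (by linarith)) hw.le

/-- Scaling a bundle of positive cost so that it uses the budget increases the term of the agent
in the Lagrangian. -/
lemma IsClassical.agent_le_scaled (hM : M.IsClassical) {p : Fin m → ℝ} {i : Fin n}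
    {z : Fin m → ℝ} (hz : z ∈ M.logDomain i) (hc : 0 < cost p z) :
    M.budget i * Real.log (M.utility i z) - cost p z ≤
      M.budget i * Real.log (M.utility i ((M.budget i / cost p z) • z)) - M.budget i := by
  have hw := hM.budget_pos i
  rw [hM.log_utility_smul hz (div_pos hw hc), ← inv_div, Real.log_inv]
  have h1 := mul_le_mul_of_nonneg_left (Real.log_le_sub_one_of_pos (div_pos hc hw)) hw.le
  have h2 : M.budget i * (cost p z / M.budget i - 1) = cost p z - M.budget i := by field_simp
  linarith

/-- Every competing bundle can first be rescaled to use exactly the budget, which does not lower its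
Lagrangian term. Among bundles of that cost, demand optimality decides. -/
lemma IsEquilibrium.isSaddlePoint (hM : M.IsClassical) {p : Fin m → ℝ}
    {x : Fin n → Fin m → ℝ} (h : M.IsEquilibrium p x) : M.IsSaddlePoint p x := by
  have hmem : ∀ i, x i ∈ M.logDomain i := fun i => (h.optimal i).mem_logDomain hM
  -- If a bundle of positive utility had nonpositive cost, all its multiples would be affordable and
  -- the utility unbounded.
  have hpos : ∀ i, ∀ z ∈ M.logDomain i, 0 < cost p z := by
    intro i z hz
    by_contra! hc
    have hu := hM.utility_zero i
    have ht : 0 < (M.utility i (x i) + 1) / M.utility i z :=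
      div_pos (by linarith [(hmem i).2]) hz.2
    have h1 := (h.optimal i).2 _ (hM.smul_mem_logDomain hz ht).1 (by
      rw [cost_smul]
      exact (mul_nonpos_of_nonneg_of_nonpos ht.le hc).trans (hM.budget_pos i).le)
    rw [hM.homogeneous i z hz.1 _ ht, div_mul_cancel₀ _ hz.2.ne'] at h1
    linarith
  refine ⟨hmem, h.clears, fun z hz => ?_⟩
  simp only [lagrangian, sum_mul_sum_sub_capacity, welfare]
  have hle : ∀ i, M.budget i * Real.log (M.utility i (z i)) - cost p (z i) ≤
      M.budget i * Real.log (M.utility i (x i)) - cost p (x i) := by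
    intro i
    have hw := hM.budget_pos i
    have hc := hpos i _ (hz i)
    refine (hM.agent_le_scaled (hz i) hc).trans ?_
    rw [h.budget_used i]
    have hm := hM.smul_mem_logDomain (hz i) (div_pos hw hc)
    refine sub_le_sub_right (mul_le_mul_of_nonneg_left (Real.log_le_log hm.2 ?_) hw.le) _
    refine (h.optimal i).2 _ hm.1 ?_
    rw [cost_smul, div_mul_cancel₀ _ hc.ne']
  have := Finset.sum_le_sum fun i (_ : i ∈ Finset.univ) => hle i
  simp only [Finset.sum_sub_distrib] at this
  linarith

/-! ### Existence of equilibrium prices -/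

lemma IsClassical.concaveOn_welfare (hM : M.IsClassical) :
    ConcaveOn ℝ M.allocations M.welfare := by
  refine ⟨?_, ?_⟩
  · intro x hx y hy a b ha hb hab i
    exact (hM.concaveOn_log_utility i).1 (hx i) (hy i) ha hb hab
  · intro x hx y hy a b ha hb hab
    simp only [welfare, smul_eq_mul, Finset.mul_sum, ← Finset.sum_add_distrib]
    exact Finset.sum_le_sum fun i _ =>
      (hM.concaveOn_weighted_log_utility i).2 (hx i) (hy i) ha hb hab

/-- Concavity and homogeneity make the utility superadditive, so nonnegativity turns into
monotonicity. -/
lemma IsClassical.utility_le_utility_add (hM : M.IsClassical) {i : Fin n}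
    (hu : ∀ z ∈ orthant m, 0 ≤ M.utility i z) {z d : Fin m → ℝ} (hz : z ∈ orthant m)
    (hd : d ∈ orthant m) : M.utility i z ≤ M.utility i (z + d) := by
  have h1 := (hM.concave i).2 hz hd (by norm_num : (0 : ℝ) ≤ 1 / 2)
    (by norm_num : (0 : ℝ) ≤ 1 / 2) (by norm_num)
  rw [← smul_add, ← smul_add, hM.homogeneous i _ (add_mem_orthant hz hd) _ (by norm_num)] at h1
  simp only [smul_eq_mul] at h1
  linarith [hu d hd]

/-- The Eisenberg–Gale program without multipliers: with positive capacities and nonnegative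
utilities, an allocation of the whole supply maximizes the welfare among the feasible ones. -/
lemma IsClassical.exists_welfare_maximizer (hn : 0 < n) (hM : M.IsClassical)
    (hs : ∀ j, 0 < M.capacity j) (hu : ∀ i, ∀ z ∈ orthant m, 0 ≤ M.utility i z) :
    (∃ z ∈ M.allocations, ∀ j, ∑ i, z i j < M.capacity j) ∧
    ∃ x ∈ M.allocations, (∀ j, ∑ i, x i j = M.capacity j) ∧
      ∀ z ∈ M.allocations, (∀ j, ∑ i, z i j ≤ M.capacity j) → M.welfare z ≤ M.welfare x := by
  have hslater : ∃ z ∈ M.allocations, ∀ j, ∑ i, z i j < M.capacity j := by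
    choose v hv using fun i => hM.nonempty_logDomain i
    have hev : ∀ j, ∀ᶠ t : ℝ in 𝓝[>] 0, ∑ i, (t • v i) j < M.capacity j := by
      intro j
      refine Tendsto.eventually_lt_const (hs j) (tendsto_nhdsWithin_of_tendsto_nhds ?_)
      have : Continuous fun t : ℝ => ∑ i, (t • v i) j := by
        simp only [Pi.smul_apply, smul_eq_mul]; fun_prop
      simpa using this.tendsto 0
    obtain ⟨t, ht, ht0⟩ := ((eventually_all.2 hev).and self_mem_nhdsWithin).exists
    exact ⟨fun i => t • v i, fun i => hM.smul_mem_logDomain (hv i) ht0, ht⟩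
  refine ⟨hslater, ?_⟩
  obtain ⟨v, hv, hvs⟩ := hslater
  let F : Set (Fin n → Fin m → ℝ) := {x | (∀ i, x i ∈ orthant m) ∧ ∀ j, ∑ i, x i j ≤ M.capacity j}
  have hF : IsCompact F := by
    refine (isCompact_univ_pi fun _ : Fin n => isCompact_univ_pi fun j =>
      isCompact_Icc (a := 0) (b := M.capacity j)).of_isClosed_subset ?_ ?_
    · refine IsClosed.inter (s₁ := {x : Fin n → Fin m → ℝ | ∀ i, x i ∈ orthant m})
        (s₂ := {x : Fin n → Fin m → ℝ | ∀ j, ∑ i, x i j ≤ M.capacity j}) ?_ ?_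
      · simp only [Set.ofPred_forall]
        exact isClosed_iInter fun i => isClosed_orthant.preimage (continuous_apply i)
      · simp only [Set.ofPred_forall]
        exact isClosed_iInter fun j => isClosed_le (by fun_prop) continuous_const
    · intro x hx i _ j _
      exact ⟨hx.1 i j, (Finset.single_le_sum (f := fun i => x i j) (fun i _ => hx.1 i j)
        (Finset.mem_univ i)).trans (hx.2 j)⟩
  -- The exponential of the welfare is maximized instead, since it stays continuous where utilities
  -- vanish.
  have hcont : ContinuousOn (fun x : Fin n → Fin m → ℝ => ∏ i, M.utility i (x i) ^ M.budget i)
      F := by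
    refine continuousOn_finsetProd _ fun i _ => ContinuousOn.rpow_const ?_
      fun x _ => Or.inr (hM.budget_pos i).le
    exact (hM.continuous i).comp (continuous_apply i).continuousOn fun x hx => hx.1 i
  have hvF : v ∈ F := ⟨fun i => (hv i).1, fun j => (hvs j).le⟩
  obtain ⟨x, hx, hmax⟩ := hF.exists_isMaxOn ⟨v, hvF⟩ hcont
  have hprod : ∀ z ∈ M.allocations, 0 < ∏ i, M.utility i (z i) ^ M.budget i := fun z hz =>
    Finset.prod_pos fun i _ => Real.rpow_pos_of_pos (hz i).2 _
  have hlog : ∀ z ∈ M.allocations,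
      Real.log (∏ i, M.utility i (z i) ^ M.budget i) = M.welfare z := by
    intro z hz
    rw [Real.log_prod fun i _ => (Real.rpow_pos_of_pos (hz i).2 _).ne']
    exact Finset.sum_congr rfl fun i _ => Real.log_rpow (hz i).2 _
  have hxmem : x ∈ M.allocations := by
    refine fun i => ⟨hx.1 i, (hu i _ (hx.1 i)).lt_of_ne fun h0 => ?_⟩
    have h1 : ∏ i, M.utility i (v i) ^ M.budget i ≤ ∏ i, M.utility i (x i) ^ M.budget i := hmax hvF
    rw [Finset.prod_eq_zero (f := fun i => M.utility i (x i) ^ M.budget i) (Finset.mem_univ i)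
      (by rw [← h0, Real.zero_rpow (hM.budget_pos i).ne'])] at h1
    exact (hprod v hv).not_ge h1
  -- All unsold supply goes to one agent, which lowers no utility and makes the market clear.
  let i₀ : Fin n := ⟨0, hn⟩
  let e : Fin m → ℝ := fun j => M.capacity j - ∑ i, x i j
  have he : e ∈ orthant m := fun j => sub_nonneg.2 (hx.2 j)
  have hle : ∀ i, M.utility i (x i) ≤ M.utility i (Function.update x i₀ (x i₀ + e) i) := by
    intro i
    rcases eq_or_ne i i₀ with rfl | hi
    · simpa using hM.utility_le_utility_add (hu _) (hx.1 _) he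
    · simp [hi]
  have hmem : Function.update x i₀ (x i₀ + e) ∈ M.allocations := by
    intro i
    refine ⟨?_, (hxmem i).2.trans_le (hle i)⟩
    rcases eq_or_ne i i₀ with rfl | hi
    · simpa using add_mem_orthant (hx.1 _) he
    · simpa [hi] using hx.1 i
  refine ⟨_, hmem, ?_, ?_⟩
  · intro j
    rw [← Finset.add_sum_erase _ _ (Finset.mem_univ i₀), Finset.sum_congr rfl fun l hl => by
      rw [Function.update_of_ne (Finset.ne_of_mem_erase hl)]]
    have := Finset.add_sum_erase Finset.univ (fun i => x i j) (Finset.mem_univ i₀)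
    simp only [Function.update_self, Pi.add_apply, e]
    linarith
  · intro z hz hzs
    calc M.welfare z ≤ M.welfare x := by
          rw [← hlog z hz, ← hlog x hxmem]
          exact Real.log_le_log (hprod z hz) (hmax (a := z) ⟨fun i => (hz i).1, hzs⟩)
      _ ≤ _ := Finset.sum_le_sum fun i _ => mul_le_mul_of_nonneg_left
          (Real.log_le_log (hxmem i).2 (hle i)) (hM.budget_pos i).le

/-- Multipliers of the capacity constraints, obtained by separating the point of the optimal value
from the open convex set of the pairs of a supply vector and a welfare level below what that
supply permits. -/
lemma IsClassical.exists_isSaddlePoint (hn : 0 < n) (hM : M.IsClassical)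
    (hs : ∀ j, 0 < M.capacity j) (hu : ∀ i, ∀ z ∈ orthant m, 0 ≤ M.utility i z) :
    ∃ p x, M.IsSaddlePoint p x := by
  obtain ⟨⟨v, hv, hvs⟩, x, hx, hxs, hmax⟩ := hM.exists_welfare_maximizer hn hs hu
  let A : Set ((Fin m → ℝ) × ℝ) :=
    {a | ∃ z ∈ M.allocations, (∀ j, ∑ i, z i j < a.1 j) ∧ a.2 < M.welfare z}
  have hAo : IsOpen A := by
    have : A = ⋃ z ∈ M.allocations,
        ((⋂ j, {a : (Fin m → ℝ) × ℝ | ∑ i, z i j < a.1 j}) ∩ {a | a.2 < M.welfare z}) := by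
      ext a
      simp only [A, Set.mem_ofPred_eq, Set.mem_iUnion, Set.mem_inter_iff, Set.mem_iInter,
        exists_prop]
    rw [this]
    refine isOpen_biUnion fun z _ => IsOpen.inter (isOpen_iInter_of_finite fun j => ?_) ?_
    · exact isOpen_lt continuous_const (by fun_prop)
    · exact isOpen_lt continuous_snd continuous_const
  have hAc : Convex ℝ A := by
    refine convex_iff_forall_pos.2 ?_
    rintro a ⟨z, hz, hza, hwa⟩ b ⟨z', hz', hzb, hwb⟩ s t hs ht hst
    refine ⟨s • z + t • z', hM.concaveOn_welfare.1 hz hz' hs.le ht.le hst, fun j => ?_, ?_⟩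
    · simp only [Pi.add_apply, Pi.smul_apply, smul_eq_mul, Finset.sum_add_distrib,
        ← Finset.mul_sum, Prod.fst_add, Prod.smul_fst]
      exact add_lt_add (mul_lt_mul_of_pos_left (hza j) hs) (mul_lt_mul_of_pos_left (hzb j) ht)
    · refine lt_of_lt_of_le ?_ (hM.concaveOn_welfare.2 hz hz' hs.le ht.le hst)
      simp only [Prod.snd_add, Prod.smul_snd, smul_eq_mul]
      exact add_lt_add (mul_lt_mul_of_pos_left hwa hs) (mul_lt_mul_of_pos_left hwb ht)
  have hnot : (M.capacity, M.welfare x) ∉ A := by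
    rintro ⟨z, hz, hza, hwa⟩
    exact (hmax z hz fun j => (hza j).le).not_gt hwa
  obtain ⟨f, hf⟩ := geometric_hahn_banach_open_point hAc hAo hnot
  obtain ⟨d, hd⟩ : ∃ d, d = f (0, 1) := ⟨_, rfl⟩
  obtain ⟨c, hc⟩ : ∃ c : Fin m → ℝ, c = fun j => f (Pi.single j 1, 0) := ⟨_, rfl⟩
  have hfe : ∀ b t, f (b, t) = cost c b + d * t := by
    intro b t
    have e : ((b, t) : (Fin m → ℝ) × ℝ) =
        ∑ j, b j • ((Pi.single j 1, 0) : (Fin m → ℝ) × ℝ) + t • (0, 1) := by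
      ext j
      · simp [Prod.fst_sum, Finset.sum_apply, Pi.single_apply]
      · simp [Prod.snd_sum]
    rw [e, map_add, map_sum, map_smul, ← hd, smul_eq_mul, mul_comm t d]
    simp only [map_smul, smul_eq_mul, cost, hc]
    congr 1
    exact Finset.sum_congr rfl fun j _ => mul_comm _ _
  -- The Slater point `v` makes the hyperplane non-vertical: it gives a point of `A` over the same
  -- supply with lower welfare.
  have hdpos : 0 < d := by
    have hmem : (M.capacity, M.welfare v - 1) ∈ A := ⟨v, hv, hvs, sub_one_lt _⟩
    have h1 := hf _ hmem
    rw [hfe, hfe] at h1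
    have h2 := hmax v hv fun j => (hvs j).le
    by_contra! h3
    have : d * M.welfare x ≤ d * (M.welfare v - 1) :=
      mul_le_mul_of_nonpos_left (by linarith) h3
    linarith
  have hsupp : ∀ z ∈ M.allocations,
      ∑ i, cost c (z i) + d * M.welfare z ≤ cost c M.capacity + d * M.welfare x := by
    intro z hz
    -- The boundary point given by `z` is pushed into the open set `A` by `t`, and then `t` tends to
    -- zero.
    have key : ∀ t : ℝ, 0 < t → cost c ((fun j => ∑ i, z i j) + t • 1) + d * (M.welfare z - t) ≤
        cost c M.capacity + d * M.welfare x := by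
      intro t ht
      rw [← hfe, ← hfe]
      refine (hf _ ⟨z, hz, fun j => ?_, by simpa using ht⟩).le
      simpa using ht
    have hsum : ∑ i, cost c (z i) = cost c (fun j => ∑ i, z i j) := by
      simp only [cost, Finset.mul_sum]
      rw [Finset.sum_comm]
    rw [hsum]
    refine le_of_tendsto (x := 𝓝[>] (0 : ℝ)) (f := fun t : ℝ =>
      cost c ((fun j => ∑ i, z i j) + t • 1) + d * (M.welfare z - t)) ?_ ?_
    · refine tendsto_nhdsWithin_of_tendsto_nhds ?_
      have : Continuous fun t : ℝ =>
          cost c ((fun j => ∑ i, z i j) + t • 1) + d * (M.welfare z - t) :=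
        ((continuous_cost c).comp (by fun_prop)).add (by fun_prop)
      simpa using this.tendsto 0
    · filter_upwards [self_mem_nhdsWithin] with t ht using key t ht
  refine ⟨(-d⁻¹) • c, x, hx, hxs, fun z hz => ?_⟩
  rw [lagrangian_eq_welfare hxs, lagrangian, sum_mul_sum_sub_capacity]
  have hcost : ∀ b, cost ((-d⁻¹) • c) b = -d⁻¹ * cost c b := by
    intro b
    simp only [cost, Finset.mul_sum, Pi.smul_apply, smul_eq_mul, mul_assoc]
  simp only [hcost, ← Finset.mul_sum]
  have h1 := mul_le_mul_of_nonneg_left (hsupp z hz) (inv_pos.2 hdpos).le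
  rw [mul_add, mul_add, inv_mul_cancel_left₀ hdpos.ne', inv_mul_cancel_left₀ hdpos.ne'] at h1
  linarith

/-! ### The basic inequality for the iterates -/

/-- The excess demand at the baseline demands `y`. -/
def excess (M : FisherMarket n m) (y : Fin n → Fin m → ℝ) (j : Fin m) : ℝ :=
  ∑ i, y i j - M.capacity j

/-- The weighted squared length of a displacement of prices, baseline demands and excess
demands. -/
noncomputable def energy (n : ℕ) {m : ℕ} (β : ℝ) (dp : Fin m → ℝ) (dy : Fin n → Fin m → ℝ)
    (dr : Fin m → ℝ) : ℝ :=
  -- The weight `n + 1` arises because the excess of `x` is `(n + 1) / β` times the price step. The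
  -- last term absorbs the cross term between `x - y` and the baseline step.
  (n + 1) / (2 * β) * ∑ j, dp j ^ 2 + β / 2 * ∑ i, ∑ j, dy i j ^ 2 + β / 2 * ∑ j, dr j ^ 2

lemma energy_eq_sum (dp : Fin m → ℝ) (dy : Fin n → Fin m → ℝ) (dr : Fin m → ℝ) :
    energy n β dp dy dr = ∑ j, ((n + 1) / (2 * β) * dp j ^ 2 + β / 2 * ∑ i, dy i j ^ 2
      + β / 2 * dr j ^ 2) := by
  rw [energy, Finset.sum_comm]
  simp only [Finset.mul_sum, Finset.sum_add_distrib]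

lemma energy_terms_nonneg (hβ : 0 < β) (dp : Fin m → ℝ) (dy : Fin n → Fin m → ℝ) (dr : Fin m → ℝ) :
    0 ≤ (n + 1) / (2 * β) * ∑ j, dp j ^ 2 ∧ 0 ≤ β / 2 * ∑ i, ∑ j, dy i j ^ 2 ∧
      0 ≤ β / 2 * ∑ j, dr j ^ 2 :=
  ⟨mul_nonneg (by positivity) (Finset.sum_nonneg fun j _ => sq_nonneg _),
    mul_nonneg (by positivity) (Finset.sum_nonneg fun i _ => Finset.sum_nonneg fun j _ =>
      sq_nonneg _),
    mul_nonneg (by positivity) (Finset.sum_nonneg fun j _ => sq_nonneg _)⟩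

lemma energy_nonneg (hβ : 0 < β) (dp : Fin m → ℝ) (dy : Fin n → Fin m → ℝ) (dr : Fin m → ℝ) :
    0 ≤ energy n β dp dy dr := by
  obtain ⟨h1, h2, h3⟩ := energy_terms_nonneg hβ dp dy dr
  unfold energy
  positivity

lemma sq_price_le_energy (hβ : 0 < β) (dp : Fin m → ℝ) (dy : Fin n → Fin m → ℝ)
    (dr : Fin m → ℝ) (j : Fin m) : dp j ^ 2 ≤ 2 * β * energy n β dp dy dr := by
  obtain ⟨h1, h2, h3⟩ := energy_terms_nonneg hβ dp dy dr
  have h4 : dp j ^ 2 ≤ ∑ j, dp j ^ 2 :=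
    Finset.single_le_sum (f := fun j => dp j ^ 2) (fun j _ => sq_nonneg _) (Finset.mem_univ j)
  have h5 : (0 : ℝ) ≤ n * ∑ j, dp j ^ 2 := mul_nonneg (Nat.cast_nonneg _) ((sq_nonneg _).trans h4)
  have h6 : 2 * β * ((n + 1) / (2 * β) * ∑ j, dp j ^ 2) = (n + 1) * ∑ j, dp j ^ 2 := by
    field_simp
  have h7 : (n + 1) / (2 * β) * ∑ j, dp j ^ 2 ≤ energy n β dp dy dr := by
    unfold energy; linarith
  have := mul_le_mul_of_nonneg_left h7 (by positivity : 0 ≤ 2 * β)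
  linarith

lemma sq_baseline_le_energy (hβ : 0 < β) (dp : Fin m → ℝ) (dy : Fin n → Fin m → ℝ)
    (dr : Fin m → ℝ) (i : Fin n) (j : Fin m) :
    dy i j ^ 2 ≤ 2 / β * energy n β dp dy dr := by
  obtain ⟨h1, h2, h3⟩ := energy_terms_nonneg hβ dp dy dr
  have h4 : dy i j ^ 2 ≤ ∑ j, dy i j ^ 2 :=
    Finset.single_le_sum (f := fun j => dy i j ^ 2) (fun j _ => sq_nonneg _) (Finset.mem_univ j)
  have h5 : ∑ j, dy i j ^ 2 ≤ ∑ i, ∑ j, dy i j ^ 2 :=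
    Finset.single_le_sum (f := fun i => ∑ j, dy i j ^ 2)
      (fun i _ => Finset.sum_nonneg fun j _ => sq_nonneg _) (Finset.mem_univ i)
  have h6 : 2 / β * (β / 2 * ∑ i, ∑ j, dy i j ^ 2) = ∑ i, ∑ j, dy i j ^ 2 := by
    field_simp
  have h7 : β / 2 * ∑ i, ∑ j, dy i j ^ 2 ≤ energy n β dp dy dr := by
    unfold energy; linarith
  have := mul_le_mul_of_nonneg_left h7 (by positivity : 0 ≤ 2 / β)
  linarith

/-- The squared distance of iterate number `k` to the prices `q` and the allocation `z`. -/
noncomputable def lyapunov (M : FisherMarket n m) (β : ℝ) (p : ℕ → Fin m → ℝ)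
    (y : ℕ → Fin n → Fin m → ℝ) (z : Fin n → Fin m → ℝ) (q : Fin m → ℝ) (k : ℕ) : ℝ :=
  energy n β (q - p k) (z - y k) (M.excess (y k))

/-- The squared length of the step from iterate number `k` to the next one. -/
noncomputable def stepEnergy (M : FisherMarket n m) (β : ℝ) (p : ℕ → Fin m → ℝ)
    (y : ℕ → Fin n → Fin m → ℝ) (k : ℕ) : ℝ :=
  energy n β (p (k + 1) - p k) (y (k + 1) - y k) (M.excess (y (k + 1)) - M.excess (y k))

section

variable (p : ℕ → Fin m → ℝ) (y : ℕ → Fin n → Fin m → ℝ) (z : Fin n → Fin m → ℝ)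
  (q : Fin m → ℝ) (k : ℕ)

lemma lyapunov_nonneg (hβ : 0 < β) : 0 ≤ M.lyapunov β p y z q k := energy_nonneg hβ _ _ _

lemma stepEnergy_nonneg (hβ : 0 < β) : 0 ≤ M.stepEnergy β p y k := energy_nonneg hβ _ _ _

lemma sq_price_sub_le_lyapunov (hβ : 0 < β) (j : Fin m) :
    (q j - p k j) ^ 2 ≤ 2 * β * M.lyapunov β p y z q k :=
  sq_price_le_energy hβ (q - p k) (z - y k) (M.excess (y k)) j

lemma sq_baseline_sub_le_lyapunov (hβ : 0 < β) (i : Fin n) (j : Fin m) :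
    (z i j - y k i j) ^ 2 ≤ 2 / β * M.lyapunov β p y z q k :=
  sq_baseline_le_energy hβ (q - p k) (z - y k) (M.excess (y k)) i j

lemma sq_price_step_le (hβ : 0 < β) (j : Fin m) :
    (p (k + 1) j - p k j) ^ 2 ≤ 2 * β * M.stepEnergy β p y k :=
  sq_price_le_energy hβ (p (k + 1) - p k) (y (k + 1) - y k)
    (M.excess (y (k + 1)) - M.excess (y k)) j

lemma sq_baseline_step_le (hβ : 0 < β) (i : Fin n) (j : Fin m) :
    (y (k + 1) i j - y k i j) ^ 2 ≤ 2 / β * M.stepEnergy β p y k :=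
  sq_baseline_le_energy hβ (p (k + 1) - p k) (y (k + 1) - y k)
    (M.excess (y (k + 1)) - M.excess (y k)) i j

end

/-! ### Optimality conditions along the iteration and the two descent inequalities -/

namespace IsADMM

variable {p : ℕ → Fin m → ℝ} {x y : ℕ → Fin n → Fin m → ℝ}

lemma demand_mem_allocations (h : M.IsADMM β p x y) (k : ℕ) : x (k + 1) ∈ M.allocations :=
  h.demand_mem k

lemma price_succ (h : M.IsADMM β p x y) (k : ℕ) (j : Fin m) :
    p (k + 1) j = p k j + β * M.excess (y (k + 1)) j := h.price_update k j

lemma demand_eq (h : M.IsADMM β p x y) (hβ : 0 < β) (k : ℕ) (i : Fin n) (j : Fin m) :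
    x (k + 1) i j = y (k + 1) i j + M.excess (y (k + 1)) j := by
  rw [excess, (isMaxOn_baselineObjective_iff hβ _ _).1 (h.baseline_max k), sum_baselineUpdate,
    baselineUpdate]
  ring

lemma demand_excess_eq (h : M.IsADMM β p x y) (hβ : 0 < β) (k : ℕ) (j : Fin m) :
    ∑ i, x (k + 1) i j - M.capacity j = (n + 1) * M.excess (y (k + 1)) j := by
  rw [excess, (isMaxOn_baselineObjective_iff hβ _ _).1 (h.baseline_max k), sum_baselineUpdate]
  have : (n : ℝ) + 1 ≠ 0 := by positivity
  field_simp

lemma welfare_sub_le (h : M.IsADMM β p x y) (hM : M.IsClassical) (hβ : 0 < β) (k : ℕ)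
    {z : Fin n → Fin m → ℝ} (hz : z ∈ M.allocations) :
    M.welfare z - M.welfare (x (k + 1)) ≤ ∑ i, ∑ j,
      (p (k + 1) j + β * (y (k + 1) i j - y k i j)) * (z i j - x (k + 1) i j) := by
  unfold welfare
  rw [← Finset.sum_sub_distrib]
  refine Finset.sum_le_sum fun i _ => ?_
  refine (hM.agentObjective_variational (h.demand_mem k i) (h.demand_max k i) (hz i)).trans
    (Finset.sum_le_sum fun j _ => le_of_eq ?_)
  rw [h.price_succ k j, h.demand_eq hβ k i j]
  ring

/-- Each product is polarized as `2ab = a² + b² - (a - b)²`, so the gap for one good becomes a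
telescoping difference minus a squared step. -/
lemma good_identity (h : M.IsADMM β p x y) (hβ : 0 < β) (k : ℕ) (z : Fin n → Fin m → ℝ)
    (q : Fin m → ℝ) (j : Fin m) :
    ∑ i, (p (k + 1) j + β * (y (k + 1) i j - y k i j)) * (z i j - x (k + 1) i j)
        - p (k + 1) j * (∑ i, z i j - M.capacity j) + q j * (∑ i, x (k + 1) i j - M.capacity j)
      = ((n + 1) / (2 * β) * (q j - p k j) ^ 2 + β / 2 * ∑ i, (z i j - y k i j) ^ 2
          + β / 2 * M.excess (y k) j ^ 2)
        - ((n + 1) / (2 * β) * (q j - p (k + 1) j) ^ 2 + β / 2 * ∑ i, (z i j - y (k + 1) i j) ^ 2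
          + β / 2 * M.excess (y (k + 1)) j ^ 2)
        - ((n + 1) / (2 * β) * (p (k + 1) j - p k j) ^ 2
          + β / 2 * ∑ i, (y (k + 1) i j - y k i j) ^ 2
          + β / 2 * (M.excess (y (k + 1)) j - M.excess (y k) j) ^ 2) := by
  have hx := h.demand_excess_eq hβ k j
  have hp := h.price_succ k j
  have hr' : ∑ i, y (k + 1) i j = M.excess (y (k + 1)) j + M.capacity j := by simp [excess]
  have hr : ∑ i, y k i j = M.excess (y k) j + M.capacity j := by simp [excess]
  generalize hP : M.excess (y (k + 1)) j = r' at *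
  have e1 : ∀ i, (p (k + 1) j + β * (y (k + 1) i j - y k i j)) * (z i j - x (k + 1) i j)
      = p (k + 1) j * (z i j - x (k + 1) i j) - β * r' * (y (k + 1) i j - y k i j)
        + (β / 2 * (z i j - y k i j) ^ 2 - β / 2 * (z i j - y (k + 1) i j) ^ 2
        - β / 2 * (y (k + 1) i j - y k i j) ^ 2) := by
    intro i
    rw [h.demand_eq hβ k i j, hP]
    ring
  rw [Finset.sum_congr rfl fun i _ => e1 i]
  simp only [Finset.sum_add_distrib, Finset.sum_sub_distrib, ← Finset.mul_sum]
  rw [hr, hr', show ∑ i, x (k + 1) i j = (n + 1) * r' + M.capacity j by linarith,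
    show p k j = p (k + 1) j - β * r' by linarith]
  field_simp
  ring

/-- The basic inequality: the primal-dual gap of an iterate is at most the decrease of the squared
distance, less the squared length of the step. -/
lemma lagrangian_sub_le (h : M.IsADMM β p x y) (hM : M.IsClassical) (hβ : 0 < β) (k : ℕ)
    {z : Fin n → Fin m → ℝ} (hz : z ∈ M.allocations) (q : Fin m → ℝ) :
    M.lagrangian z (p (k + 1)) - M.lagrangian (x (k + 1)) q ≤
      M.lyapunov β p y z q k - M.lyapunov β p y z q (k + 1) - M.stepEnergy β p y k := by
  have h1 := h.welfare_sub_le hM hβ k hz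
  rw [Finset.sum_comm] at h1
  have h2 := Finset.sum_congr rfl fun j (_ : j ∈ Finset.univ) => h.good_identity hβ k z q j
  simp only [lyapunov, stepEnergy, energy_eq_sum, Pi.sub_apply, lagrangian]
  rw [← Finset.sum_sub_distrib, ← Finset.sum_sub_distrib, ← h2, Finset.sum_add_distrib,
    Finset.sum_sub_distrib]
  linarith

/-- Two consecutive optimality conditions are tested at each other's demands and added, so the
welfare cancels. This is monotonicity of the supergradients; the discarded terms are squares of
first differences of the excess and of second differences. -/
lemma stepEnergy_succ_le (h : M.IsADMM β p x y) (hM : M.IsClassical) (hβ : 0 < β) (k : ℕ) :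
    M.stepEnergy β p y (k + 1) ≤ M.stepEnergy β p y k := by
  have h1 := h.welfare_sub_le hM hβ k (h.demand_mem_allocations (k + 1))
  have h2 := h.welfare_sub_le hM hβ (k + 1) (h.demand_mem_allocations k)
  rw [Finset.sum_comm] at h1 h2
  have h3 : ∀ j,
      ∑ i, (p (k + 1) j + β * (y (k + 1) i j - y k i j)) * (x (k + 2) i j - x (k + 1) i j)
      + ∑ i, (p (k + 2) j + β * (y (k + 2) i j - y (k + 1) i j)) * (x (k + 1) i j - x (k + 2) i j)
      ≤ ((n + 1) / (2 * β) * (p (k + 1) j - p k j) ^ 2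
          + β / 2 * ∑ i, (y (k + 1) i j - y k i j) ^ 2
          + β / 2 * (M.excess (y (k + 1)) j - M.excess (y k) j) ^ 2)
        - ((n + 1) / (2 * β) * (p (k + 2) j - p (k + 1) j) ^ 2
          + β / 2 * ∑ i, (y (k + 2) i j - y (k + 1) i j) ^ 2
          + β / 2 * (M.excess (y (k + 2)) j - M.excess (y (k + 1)) j) ^ 2) := by
    intro j
    have hr2 : ∑ i, y (k + 2) i j = M.excess (y (k + 2)) j + M.capacity j := by simp [excess]
    have hr1 : ∑ i, y (k + 1) i j = M.excess (y (k + 1)) j + M.capacity j := by simp [excess]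
    have hr0 : ∑ i, y k i j = M.excess (y k) j + M.capacity j := by simp [excess]
    have hp1 := h.price_succ k j
    have hp2 := h.price_succ (k + 1) j
    have hx1 := fun i => h.demand_eq hβ k i j
    have hx2 := fun i => h.demand_eq hβ (k + 1) i j
    simp only [add_assoc, Nat.reduceAdd] at hp2 hx2
    generalize M.excess (y (k + 2)) j = r2 at *
    generalize M.excess (y (k + 1)) j = r1 at *
    generalize M.excess (y k) j = r0 at *
    have e : ∀ i,
        (p (k + 1) j + β * (y (k + 1) i j - y k i j)) * (x (k + 2) i j - x (k + 1) i j)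
        + (p (k + 2) j + β * (y (k + 2) i j - y (k + 1) i j)) * (x (k + 1) i j - x (k + 2) i j)
        = -(β * (2 * r2 - r1)) * (y (k + 2) i j - y (k + 1) i j)
          + β * (r2 - r1) * (y (k + 1) i j - y k i j)
          - β * r2 * (r2 - r1)
          + (β / 2 * (y (k + 1) i j - y k i j) ^ 2 - β / 2 * (y (k + 2) i j - y (k + 1) i j) ^ 2
            - β / 2 * ((y (k + 2) i j - y (k + 1) i j) - (y (k + 1) i j - y k i j)) ^ 2) := by
      intro i
      rw [hx1, hx2, hp2, hp1]
      ring
    rw [← Finset.sum_add_distrib, Finset.sum_congr rfl fun i _ => e i]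
    have hnn : 0 ≤ β / 2 * ∑ i, ((y (k + 2) i j - y (k + 1) i j) - (y (k + 1) i j - y k i j)) ^ 2 :=
      mul_nonneg (by positivity) (Finset.sum_nonneg fun i _ => sq_nonneg _)
    have hnn2 : 0 ≤ β / 2 * ((r2 - r1) - (r1 - r0)) ^ 2 := by positivity
    have hnn3 : 0 ≤ (n : ℝ) * (β / 2 * (r2 - r1) ^ 2) := by positivity
    have hnn4 : 0 ≤ β / 2 * (r2 - r1) ^ 2 := by positivity
    have ep1 : (n + 1) / (2 * β) * (p (k + 1) j - p k j) ^ 2 = (n + 1) * (β / 2 * r1 ^ 2) := by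
      rw [hp1]; field_simp; ring
    have ep2 : (n + 1) / (2 * β) * (p (k + 2) j - p (k + 1) j) ^ 2
        = (n + 1) * (β / 2 * r2 ^ 2) := by
      rw [hp2]; field_simp; ring
    rw [ep1, ep2]
    simp only [Finset.sum_add_distrib, Finset.sum_sub_distrib, ← Finset.mul_sum,
      Finset.sum_const, Finset.card_univ, Fintype.card_fin, nsmul_eq_mul] at hnn ⊢
    rw [hr0, hr1, hr2]
    linarith
  have h4 := Finset.sum_le_sum fun j (_ : j ∈ Finset.univ) => h3 j
  rw [Finset.sum_add_distrib, Finset.sum_sub_distrib] at h4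
  simp only [stepEnergy, energy_eq_sum, Pi.sub_apply]
  simp only [add_assoc, Nat.reduceAdd] at h2 h4 ⊢
  linarith

end IsADMM

/-! ### Convergence of the iterates -/

lemma tendsto_zero_of_sq_le {a e : ℕ → ℝ} {C : ℝ} (h : ∀ k, a k ^ 2 ≤ C * e k)
    (he : Tendsto e atTop (𝓝 0)) : Tendsto a atTop (𝓝 0) := by
  refine squeeze_zero_norm (fun k => Real.abs_le_sqrt (h k)) ?_
  simpa using (he.const_mul C).sqrt

lemma IsClassical.tendsto_utility (hM : M.IsClassical) {X : ℕ → Fin n → Fin m → ℝ}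
    (hX : ∀ k, X k ∈ M.allocations) {x : Fin n → Fin m → ℝ} (hlim : Tendsto X atTop (𝓝 x))
    (i : Fin n) : x i ∈ orthant m ∧
      Tendsto (fun k => M.utility i (X k i)) atTop (𝓝 (M.utility i (x i))) := by
  have hi := tendsto_pi_nhds.1 hlim i
  have hx : x i ∈ orthant m :=
    isClosed_orthant.mem_of_tendsto hi (Eventually.of_forall fun k => (hX k i).1)
  refine ⟨hx, ((hM.continuous i) (x i) hx).tendsto.comp ?_⟩
  exact tendsto_nhdsWithin_iff.2 ⟨hi, Eventually.of_forall fun k => (hX k i).1⟩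

lemma IsClassical.tendsto_welfare (hM : M.IsClassical) {X : ℕ → Fin n → Fin m → ℝ}
    (hX : ∀ k, X k ∈ M.allocations) {x : Fin n → Fin m → ℝ} (hx : x ∈ M.allocations)
    (hlim : Tendsto X atTop (𝓝 x)) :
    Tendsto (fun k => M.welfare (X k)) atTop (𝓝 (M.welfare x)) :=
  tendsto_finsetSum _ fun i _ => ((hM.tendsto_utility hX hlim i).2.log (hx i).2.ne').const_mul _

/-- A limit of allocations whose welfare is bounded below has positive utilities. -/
lemma IsClassical.mem_allocations_of_tendsto (hM : M.IsClassical)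
    {X : ℕ → Fin n → Fin m → ℝ} (hX : ∀ k, X k ∈ M.allocations) {x : Fin n → Fin m → ℝ}
    (hlim : Tendsto X atTop (𝓝 x)) {T : ℕ → ℝ} (hT : ∀ k, T k ≤ M.welfare (X k)) {T' : ℝ}
    (hTlim : Tendsto T atTop (𝓝 T')) : x ∈ M.allocations := by
  intro i
  have hu := fun l => hM.tendsto_utility hX hlim l
  refine ⟨(hu i).1, ?_⟩
  have h0 : 0 ≤ M.utility i (x i) :=
    ge_of_tendsto (hu i).2 (Eventually.of_forall fun k => (hX k i).2.le)
  refine h0.lt_of_ne fun h => ?_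
  have hi := (hu i).2
  rw [← h] at hi
  have hlog : Tendsto (fun k => M.budget i * Real.log (M.utility i (X k i))) atTop atBot :=
    (Real.tendsto_log_nhdsGT_zero.comp (tendsto_nhdsWithin_iff.2
      ⟨hi, Eventually.of_forall fun k => (hX k i).2⟩)).const_mul_atBot (hM.budget_pos i)
  -- The other agents cannot compensate for a logarithm tending to `-∞`, because `log u ≤ u - 1` and
  -- their utilities converge.
  have hlow : ∀ k, T k - ∑ l ∈ Finset.univ.erase i, M.budget l * (M.utility l (X k l) - 1) ≤
      M.budget i * Real.log (M.utility i (X k i)) := by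
    intro k
    have h1 := hT k
    unfold welfare at h1
    rw [← Finset.add_sum_erase _ _ (Finset.mem_univ i)] at h1
    have h2 := Finset.sum_le_sum fun l (_ : l ∈ Finset.univ.erase i) =>
      mul_le_mul_of_nonneg_left (Real.log_le_sub_one_of_pos (hX k l).2) (hM.budget_pos l).le
    linarith
  refine not_tendsto_nhds_of_tendsto_atBot (tendsto_atBot_mono hlow hlog) _ (hTlim.sub
    (tendsto_finsetSum _ fun l _ => ((hu l).2.sub_const 1).const_mul _))

/-! ### Monotone distances to saddle points and passage to the limit -/

namespace IsADMM

variable {p : ℕ → Fin m → ℝ} {x y : ℕ → Fin n → Fin m → ℝ}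

lemma lyapunov_succ_le (h : M.IsADMM β p x y) (hM : M.IsClassical) (hβ : 0 < β)
    {q : Fin m → ℝ} {z : Fin n → Fin m → ℝ} (hs : M.IsSaddlePoint q z) (k : ℕ) :
    M.lyapunov β p y z q (k + 1) + M.stepEnergy β p y k ≤ M.lyapunov β p y z q k := by
  have h1 := h.lagrangian_sub_le hM hβ k hs.mem q
  have h2 := hs.lagrangian_le _ (h.demand_mem_allocations k)
  rw [lagrangian_eq_welfare hs.clears] at h1 h2
  linarith

lemma lyapunov_antitone (h : M.IsADMM β p x y) (hM : M.IsClassical) (hβ : 0 < β)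
    {q : Fin m → ℝ} {z : Fin n → Fin m → ℝ} (hs : M.IsSaddlePoint q z) :
    Antitone (M.lyapunov β p y z q) :=
  antitone_nat_of_succ_le fun k => by
    have h1 := h.lyapunov_succ_le hM hβ hs k
    have h2 : 0 ≤ M.stepEnergy β p y k := stepEnergy_nonneg p y k hβ
    linarith

lemma sum_stepEnergy_le (h : M.IsADMM β p x y) (hM : M.IsClassical) (hβ : 0 < β)
    {q : Fin m → ℝ} {z : Fin n → Fin m → ℝ} (hs : M.IsSaddlePoint q z) (K : ℕ) :
    ∑ k ∈ Finset.range K, M.stepEnergy β p y k ≤ M.lyapunov β p y z q 0 := by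
  have h1 : ∑ k ∈ Finset.range K, M.stepEnergy β p y k ≤
      M.lyapunov β p y z q 0 - M.lyapunov β p y z q K := by
    rw [← Finset.sum_range_sub']
    exact Finset.sum_le_sum fun k _ => by linarith [h.lyapunov_succ_le hM hβ hs k]
  have h2 : 0 ≤ M.lyapunov β p y z q K := lyapunov_nonneg p y z q K hβ
  linarith

/-- The step lengths decrease, so `k + 1` times the last is at most their sum, which is bounded. -/
lemma stepEnergy_le_div (h : M.IsADMM β p x y) (hM : M.IsClassical) (hβ : 0 < β)
    {q : Fin m → ℝ} {z : Fin n → Fin m → ℝ} (hs : M.IsSaddlePoint q z) (k : ℕ) :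
    M.stepEnergy β p y k ≤ M.lyapunov β p y z q 0 / ((k + 1 : ℕ) : ℝ) := by
  have hanti : Antitone (M.stepEnergy β p y) :=
    antitone_nat_of_succ_le fun k => h.stepEnergy_succ_le hM hβ k
  rw [le_div_iff₀ (by positivity), mul_comm]
  refine le_trans ?_ (h.sum_stepEnergy_le hM hβ hs (k + 1))
  have := Finset.card_nsmul_le_sum (Finset.range (k + 1)) (M.stepEnergy β p y)
    (M.stepEnergy β p y k) fun l hl => hanti (Nat.lt_succ_iff.1 (Finset.mem_range.1 hl))
  simpa using this

lemma tendsto_stepEnergy (h : M.IsADMM β p x y) (hM : M.IsClassical) (hβ : 0 < β)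
    {q : Fin m → ℝ} {z : Fin n → Fin m → ℝ} (hs : M.IsSaddlePoint q z) :
    Tendsto (M.stepEnergy β p y) atTop (𝓝 0) :=
  (summable_of_sum_range_le (fun k => stepEnergy_nonneg p y k hβ)
    (h.sum_stepEnergy_le hM hβ hs)).tendsto_atTop_zero

lemma tendsto_excess (h : M.IsADMM β p x y) (hM : M.IsClassical) (hβ : 0 < β)
    {q : Fin m → ℝ} {z : Fin n → Fin m → ℝ} (hs : M.IsSaddlePoint q z) (j : Fin m) :
    Tendsto (fun k => M.excess (y (k + 1)) j) atTop (𝓝 0) := by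
  have h1 : Tendsto (fun k => p (k + 1) j - p k j) atTop (𝓝 0) :=
    tendsto_zero_of_sq_le (fun k => sq_price_step_le p y k hβ j) (h.tendsto_stepEnergy hM hβ hs)
  have h2 := h1.const_mul β⁻¹
  rw [mul_zero] at h2
  refine h2.congr fun k => ?_
  rw [h.price_succ, add_sub_cancel_left, inv_mul_cancel_left₀ hβ.ne']

lemma tendsto_of_lyapunov (hβ : 0 < β) {q : Fin m → ℝ} {z : Fin n → Fin m → ℝ}
    (hV : Tendsto (M.lyapunov β p y z q) atTop (𝓝 0)) :
    Tendsto p atTop (𝓝 q) ∧ Tendsto y atTop (𝓝 z) := by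
  constructor
  · refine tendsto_pi_nhds.2 fun j => ?_
    have h1 : Tendsto (fun k => q j - p k j) atTop (𝓝 0) :=
      tendsto_zero_of_sq_le (fun k => sq_price_sub_le_lyapunov p y z q k hβ j) hV
    simpa using h1.const_sub (q j)
  · refine tendsto_pi_nhds.2 fun i => tendsto_pi_nhds.2 fun j => ?_
    have h1 : Tendsto (fun k => z i j - y k i j) atTop (𝓝 0) :=
      tendsto_zero_of_sq_le (fun k => sq_baseline_sub_le_lyapunov p y z q k hβ i j) hV
    simpa using h1.const_sub (z i j)

lemma exists_convergent_subseq (h : M.IsADMM β p x y) (hM : M.IsClassical) (hβ : 0 < β)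
    {q : Fin m → ℝ} {z : Fin n → Fin m → ℝ} (hs : M.IsSaddlePoint q z) :
    ∃ q' z', ∃ φ : ℕ → ℕ, StrictMono φ ∧ Tendsto (fun k => p (φ k)) atTop (𝓝 q') ∧
      Tendsto (fun k => y (φ k)) atTop (𝓝 z') := by
  have hV := fun k => h.lyapunov_antitone hM hβ hs (Nat.zero_le k)
  have hp : ∀ k, p k ∈ Metric.closedBall q (√(2 * β * M.lyapunov β p y z q 0)) := by
    intro k
    rw [Metric.mem_closedBall', dist_pi_le_iff (Real.sqrt_nonneg _)]
    exact fun j => Real.abs_le_sqrt ((sq_price_sub_le_lyapunov p y z q k hβ j).trans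
      (mul_le_mul_of_nonneg_left (hV k) (by positivity)))
  have hy : ∀ k, y k ∈ Metric.closedBall z (√(2 / β * M.lyapunov β p y z q 0)) := by
    intro k
    rw [Metric.mem_closedBall', dist_pi_le_iff (Real.sqrt_nonneg _)]
    intro i
    rw [dist_pi_le_iff (Real.sqrt_nonneg _)]
    exact fun j => Real.abs_le_sqrt ((sq_baseline_sub_le_lyapunov p y z q k hβ i j).trans
      (mul_le_mul_of_nonneg_left (hV k) (by positivity)))
  obtain ⟨a, -, φ, hφ, hlim⟩ := tendsto_subseq_of_bounded (x := fun k => (p k, y k))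
    (Metric.isBounded_closedBall.prod Metric.isBounded_closedBall)
    (fun k => Set.mk_mem_prod (hp k) (hy k))
  exact ⟨a.1, a.2, φ, hφ, (continuous_fst.tendsto a).comp hlim,
    (continuous_snd.tendsto a).comp hlim⟩

lemma exists_tendsto_isSaddlePoint (h : M.IsADMM β p x y) (hM : M.IsClassical) (hβ : 0 < β)
    {q₀ : Fin m → ℝ} {z₀ : Fin n → Fin m → ℝ} (hs : M.IsSaddlePoint q₀ z₀) :
    ∃ q z, M.IsSaddlePoint q z ∧ Tendsto p atTop (𝓝 q) ∧ Tendsto x atTop (𝓝 z) ∧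
      Tendsto y atTop (𝓝 z) := by
  obtain ⟨q, z, φ, hφ, hpφ, hyφ⟩ := h.exists_convergent_subseq hM hβ hs
  have hr : ∀ j, Tendsto (fun k => M.excess (y (φ k + 1)) j) atTop (𝓝 0) := fun j =>
    (h.tendsto_excess hM hβ hs j).comp hφ.tendsto_atTop
  have hdy : ∀ i j, Tendsto (fun k => y (φ k + 1) i j - y (φ k) i j) atTop (𝓝 0) := fun i j =>
    (tendsto_zero_of_sq_le (a := fun k => y (k + 1) i j - y k i j)
      (fun k => sq_baseline_step_le p y k hβ i j)
      (h.tendsto_stepEnergy hM hβ hs)).comp hφ.tendsto_atTop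
  have hp1 : ∀ j, Tendsto (fun k => p (φ k + 1) j) atTop (𝓝 (q j)) := by
    intro j
    have := (tendsto_pi_nhds.1 hpφ j).add ((hr j).const_mul β)
    rw [mul_zero, add_zero] at this
    exact this.congr fun k => (h.price_succ _ j).symm
  have hy1 : ∀ i j, Tendsto (fun k => y (φ k + 1) i j) atTop (𝓝 (z i j)) := by
    intro i j
    have := (tendsto_pi_nhds.1 (tendsto_pi_nhds.1 hyφ i) j).add (hdy i j)
    rw [add_zero] at this
    exact this.congr fun k => by ring
  have hx1 : ∀ i j, Tendsto (fun k => x (φ k + 1) i j) atTop (𝓝 (z i j)) := by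
    intro i j
    have := (hy1 i j).add (hr j)
    rw [add_zero] at this
    exact this.congr fun k => (h.demand_eq hβ _ i j).symm
  have hx1' : Tendsto (fun k => x (φ k + 1)) atTop (𝓝 z) :=
    tendsto_pi_nhds.2 fun i => tendsto_pi_nhds.2 fun j => hx1 i j
  have hclears : ∀ j, ∑ i, z i j = M.capacity j := by
    intro j
    have h1 : Tendsto (fun k => M.excess (y (φ k + 1)) j) atTop
        (𝓝 (∑ i, z i j - M.capacity j)) :=
      (tendsto_finsetSum _ fun i _ => hy1 i j).sub_const _
    exact sub_eq_zero.1 (tendsto_nhds_unique h1 (hr j))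
  have hgrad : ∀ v : Fin n → Fin m → ℝ, Tendsto (fun k => ∑ i, ∑ j, (p (φ k + 1) j
      + β * (y (φ k + 1) i j - y (φ k) i j)) * (v i j - x (φ k + 1) i j)) atTop
      (𝓝 (∑ i, ∑ j, (q j + β * 0) * (v i j - z i j))) := fun v =>
    tendsto_finsetSum _ fun i _ => tendsto_finsetSum _ fun j _ =>
      ((hp1 j).add ((hdy i j).const_mul β)).mul ((hx1 i j).const_sub _)
  have hxmem := fun k => h.demand_mem_allocations (φ k)
  -- Testing optimality at the known saddle point bounds the welfare from below along the
  -- subsequence, so no utility vanishes in the limit.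
  have hmem : z ∈ M.allocations := by
    refine hM.mem_allocations_of_tendsto hxmem hx1' (fun k => ?_)
      ((hgrad z₀).const_sub (M.welfare z₀))
    linarith [h.welfare_sub_le hM hβ (φ k) hs.mem]
  have hsad : M.IsSaddlePoint q z := by
    refine ⟨hmem, hclears, fun v hv => ?_⟩
    have h1 := le_of_tendsto_of_tendsto'
      ((hM.tendsto_welfare hxmem hmem hx1').const_sub (M.welfare v)) (hgrad v)
      fun k => h.welfare_sub_le hM hβ (φ k) hv
    have h2 : ∑ i, ∑ j, (q j + β * 0) * (v i j - z i j)
        = ∑ i, cost q (v i) - ∑ i, cost q (z i) := by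
      simp only [cost, ← Finset.sum_sub_distrib, mul_zero, add_zero, mul_sub]
    simp only [lagrangian, sum_mul_sum_sub_capacity]
    linarith
  have hVφ : Tendsto (fun k => M.lyapunov β p y z q (φ k + 1)) atTop (𝓝 0) := by
    have h1 : Tendsto (fun k => M.lyapunov β p y z q (φ k + 1)) atTop
        (𝓝 ((n + 1) / (2 * β) * ∑ j, (q j - q j) ^ 2 + β / 2 * ∑ i, ∑ j, (z i j - z i j) ^ 2
          + β / 2 * ∑ j : Fin m, (0 : ℝ) ^ 2)) :=
      (((tendsto_finsetSum _ fun j _ => ((hp1 j).const_sub _).pow 2).const_mul _).add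
        ((tendsto_finsetSum _ fun i _ => tendsto_finsetSum _ fun j _ =>
          ((hy1 i j).const_sub _).pow 2).const_mul _)).add
        ((tendsto_finsetSum _ fun j _ => (hr j).pow 2).const_mul _)
    simpa using h1
  -- Here the distance is taken to the cluster point itself. It is monotone because that point is a
  -- saddle point, so the subsequence determines the limit.
  have hV : Tendsto (M.lyapunov β p y z q) atTop (𝓝 0) :=
    (tendsto_iff_tendsto_subseq_of_antitone (h.lyapunov_antitone hM hβ hsad)
      ((tendsto_add_atTop_nat 1).comp hφ.tendsto_atTop)).2 hVφ
  obtain ⟨hp, hy⟩ := tendsto_of_lyapunov hβ hV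
  refine ⟨q, z, hsad, hp, ?_, hy⟩
  rw [← tendsto_add_atTop_iff_nat 1]
  refine tendsto_pi_nhds.2 fun i => tendsto_pi_nhds.2 fun j => ?_
  have hyj := tendsto_pi_nhds.1 (tendsto_pi_nhds.1 ((tendsto_add_atTop_iff_nat 1).2 hy) i) j
  have := hyj.add (h.tendsto_excess hM hβ hs j)
  rw [add_zero] at this
  exact this.congr fun k => (h.demand_eq hβ _ i j).symm

end IsADMM

/-! ### Averages of the iterates -/

lemma average_eq {V : Type*} [AddCommGroup V] [Module ℝ V] (v : ℕ → V) (K : ℕ) :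
    average v K = (K : ℝ)⁻¹ • ∑ k ∈ Finset.range K, v (k + 1) := by
  rw [average, one_div, Finset.range_eq_Ico, Finset.sum_Ico_add' v 0 K 1, zero_add]
  rfl

lemma average_price_apply (p : ℕ → Fin m → ℝ) (K : ℕ) (j : Fin m) :
    average p K j = (K : ℝ)⁻¹ * ∑ k ∈ Finset.range K, p (k + 1) j := by
  simp [average_eq, Finset.sum_apply]

lemma average_allocation_apply (x : ℕ → Fin n → Fin m → ℝ) (K : ℕ) (i : Fin n) (j : Fin m) :
    average x K i j = (K : ℝ)⁻¹ * ∑ k ∈ Finset.range K, x (k + 1) i j := by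
  simp [average_eq, Finset.sum_apply]

lemma sum_average_sub_capacity (x : ℕ → Fin n → Fin m → ℝ) {K : ℕ} (hK : 1 ≤ K) (j : Fin m) :
    ∑ i, average x K i j - M.capacity j =
      (K : ℝ)⁻¹ * ∑ k ∈ Finset.range K, (∑ i, x (k + 1) i j - M.capacity j) := by
  have hK' : (K : ℝ) ≠ 0 := Nat.cast_ne_zero.2 (by omega)
  simp only [average_allocation_apply, Finset.sum_sub_distrib, ← Finset.mul_sum, Finset.sum_const,
    Finset.card_range, nsmul_eq_mul, mul_sub, inv_mul_cancel_left₀ hK']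
  rw [Finset.sum_comm]

lemma lagrangian_average_price (z : Fin n → Fin m → ℝ) (p : ℕ → Fin m → ℝ) {K : ℕ}
    (hK : 1 ≤ K) : M.lagrangian z (average p K) =
      (K : ℝ)⁻¹ * ∑ k ∈ Finset.range K, M.lagrangian z (p (k + 1)) := by
  have hK' : (K : ℝ) ≠ 0 := Nat.cast_ne_zero.2 (by omega)
  have h1 : ∑ j, average p K j * (∑ i, z i j - M.capacity j) = (K : ℝ)⁻¹ *
      ∑ k ∈ Finset.range K, ∑ j, p (k + 1) j * (∑ i, z i j - M.capacity j) := by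
    rw [Finset.sum_comm, Finset.mul_sum]
    refine Finset.sum_congr rfl fun j _ => ?_
    rw [average_price_apply, ← Finset.sum_mul, mul_assoc]
  unfold lagrangian
  rw [h1, Finset.sum_sub_distrib, mul_sub, Finset.sum_const, Finset.card_range, nsmul_eq_mul,
    inv_mul_cancel_left₀ hK']

lemma sum_inv_cast {K : ℕ} (hK : 1 ≤ K) : ∑ _k ∈ Finset.range K, (K : ℝ)⁻¹ = 1 := by
  have hK' : (K : ℝ) ≠ 0 := Nat.cast_ne_zero.2 (by omega)
  simp [hK']

/-! ### Rates for the averages and for the iterates themselves -/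

namespace IsADMM

variable {p : ℕ → Fin m → ℝ} {x y : ℕ → Fin n → Fin m → ℝ}

lemma average_mem (h : M.IsADMM β p x y) (hM : M.IsClassical) {K : ℕ} (hK : 1 ≤ K) :
    average x K ∈ M.allocations := by
  rw [average_eq, Finset.smul_sum]
  exact hM.concaveOn_welfare.1.sum_mem (fun _ _ => by positivity) (sum_inv_cast hK)
    fun k _ => h.demand_mem_allocations k

/-- Jensen's inequality for the concave welfare; the price term is affine in the allocation. -/
lemma le_lagrangian_average (h : M.IsADMM β p x y) (hM : M.IsClassical) {K : ℕ} (hK : 1 ≤ K)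
    (q : Fin m → ℝ) : (K : ℝ)⁻¹ * ∑ k ∈ Finset.range K, M.lagrangian (x (k + 1)) q ≤
      M.lagrangian (average x K) q := by
  have h1 := hM.concaveOn_welfare.le_map_sum (t := Finset.range K) (w := fun _ => (K : ℝ)⁻¹)
    (p := fun k => x (k + 1)) (fun _ _ => by positivity) (sum_inv_cast hK)
    fun k _ => h.demand_mem_allocations k
  rw [← Finset.smul_sum, ← Finset.smul_sum, ← average_eq, smul_eq_mul] at h1
  have h2 : ∑ j, q j * (∑ i, average x K i j - M.capacity j) = (K : ℝ)⁻¹ *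
      ∑ k ∈ Finset.range K, ∑ j, q j * (∑ i, x (k + 1) i j - M.capacity j) := by
    rw [Finset.sum_comm, Finset.mul_sum]
    refine Finset.sum_congr rfl fun j _ => ?_
    rw [sum_average_sub_capacity x hK, ← Finset.mul_sum, mul_left_comm]
  unfold lagrangian
  rw [h2, Finset.sum_sub_distrib, mul_sub]
  exact sub_le_sub_right h1 _

/-- The averaged primal-dual gap is at most the initial squared distance over the number of
iterations. -/
lemma gap_average_le (h : M.IsADMM β p x y) (hM : M.IsClassical) (hβ : 0 < β) {K : ℕ}
    (hK : 1 ≤ K) {z : Fin n → Fin m → ℝ} (hz : z ∈ M.allocations) (q : Fin m → ℝ) :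
    M.lagrangian z (average p K) - M.lagrangian (average x K) q ≤
      M.lyapunov β p y z q 0 / K := by
  have h1 := h.le_lagrangian_average hM hK q
  rw [lagrangian_average_price z p hK]
  have h2 : ∑ k ∈ Finset.range K, (M.lagrangian z (p (k + 1)) - M.lagrangian (x (k + 1)) q) ≤
      M.lyapunov β p y z q 0 - M.lyapunov β p y z q K := by
    rw [← Finset.sum_range_sub']
    refine Finset.sum_le_sum fun k _ => ?_
    have h3 := h.lagrangian_sub_le hM hβ k hz q
    have h4 : 0 ≤ M.stepEnergy β p y k := stepEnergy_nonneg p y k hβ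
    linarith
  have h5 : 0 ≤ M.lyapunov β p y z q K := lyapunov_nonneg p y z q K hβ
  have h6 := mul_le_mul_of_nonneg_left (h2.trans (sub_le_self _ h5))
    (by positivity : 0 ≤ (K : ℝ)⁻¹)
  rw [Finset.sum_sub_distrib, mul_sub, ← div_eq_inv_mul (M.lyapunov β p y z q 0)] at h6
  linarith

/-- Excess demands are multiples of price steps and telescope, so bounded prices give the rate `1 /
K`. -/
lemma excess_average_eq (h : M.IsADMM β p x y) (hβ : 0 < β) {K : ℕ} (hK : 1 ≤ K) (j : Fin m) :
    ∑ i, average x K i j - M.capacity j = (n + 1) / β * (p K j - p 0 j) / K := by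
  rw [sum_average_sub_capacity x hK]
  have h1 : ∀ k, ∑ i, x (k + 1) i j - M.capacity j = (n + 1) / β * (p (k + 1) j - p k j) := by
    intro k
    rw [h.demand_excess_eq hβ, h.price_succ]
    field_simp
    ring
  rw [Finset.sum_congr rfl fun k _ => h1 k, ← Finset.mul_sum,
    Finset.sum_range_sub (fun k => p k j), div_eq_inv_mul _ (K : ℝ)]

lemma exists_feasibility_welfare_rate (h : M.IsADMM β p x y) (hM : M.IsClassical) (hβ : 0 < β)
    {q : Fin m → ℝ} {z : Fin n → Fin m → ℝ} (hs : M.IsSaddlePoint q z)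
    (hp : Tendsto p atTop (𝓝 q)) : ∃ C : ℝ, ∀ K : ℕ, 1 ≤ K →
      (∀ j, |∑ i, average x K i j - M.capacity j| ≤ C / K) ∧
      |M.welfare (average x K) - M.welfare z| ≤ C / K := by
  obtain ⟨B, hB⟩ := (Metric.isBounded_range_of_tendsto p hp).exists_norm_le
  have hB' : ∀ k j, |p k j| ≤ B := fun k j => (norm_le_pi_norm (p k) j).trans (hB _ ⟨k, rfl⟩)
  have hB0 : 0 ≤ B := (norm_nonneg _).trans (hB _ ⟨0, rfl⟩)
  obtain ⟨C₁, hC₁⟩ : ∃ C₁ : ℝ, C₁ = (n + 1) / β * (2 * B) := ⟨_, rfl⟩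
  have hC₁0 : 0 ≤ C₁ := hC₁ ▸ by positivity
  have hex : ∀ K : ℕ, 1 ≤ K → ∀ j, |∑ i, average x K i j - M.capacity j| ≤ C₁ / K := by
    intro K hK j
    have hpos : 0 ≤ ((n : ℝ) + 1) / β := by positivity
    rw [h.excess_average_eq hβ hK, abs_div, Nat.abs_cast, abs_mul, abs_of_nonneg hpos, hC₁]
    gcongr
    refine (abs_sub _ _).trans ?_
    linarith [hB' K j, hB' 0 j]
  have hS : 0 ≤ ∑ j, |q j| := Finset.sum_nonneg fun j _ => abs_nonneg _
  have hV : 0 ≤ M.lyapunov β p y z 0 0 := lyapunov_nonneg p y z 0 0 hβ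
  refine ⟨C₁ + (∑ j, |q j|) * C₁ + M.lyapunov β p y z 0 0, fun K hK => ⟨fun j => ?_, ?_⟩⟩
  · refine (hex K hK j).trans ?_
    gcongr
    have := mul_nonneg hS hC₁0
    linarith
  -- Comparison with zero prices bounds the welfare of the average from below. The saddle inequality
  -- at `q`, with the excess demand bound, gives the upper bound.
  · have h1 := h.gap_average_le hM hβ hK hs.mem 0
    have h2 := hs.lagrangian_le _ (h.average_mem hM hK)
    rw [lagrangian_eq_welfare hs.clears] at h1 h2
    have h3 : ∑ j, q j * (∑ i, average x K i j - M.capacity j) ≤ (∑ j, |q j|) * (C₁ / K) := by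
      rw [Finset.sum_mul]
      refine Finset.sum_le_sum fun j _ => (le_abs_self _).trans ?_
      rw [abs_mul]
      exact mul_le_mul_of_nonneg_left (hex K hK j) (abs_nonneg _)
    have h4 : 0 ≤ C₁ / K := by positivity
    have h5 := mul_nonneg hS h4
    have h6 : 0 ≤ M.lyapunov β p y z 0 0 / K := by positivity
    simp only [lagrangian, Pi.zero_apply, zero_mul, Finset.sum_const_zero, sub_zero] at h1 h2
    rw [add_div, add_div, mul_div_assoc, abs_le]
    constructor <;> linarith

lemma energy_le_energy (hβ : 0 < β) {dp dp' : Fin m → ℝ} {dy dy' : Fin n → Fin m → ℝ}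
    (dr : Fin m → ℝ) (hp : ∀ j, |dp j| ≤ dp' j) (hy : ∀ i j, |dy i j| ≤ dy' i j) :
    energy n β dp dy dr ≤ energy n β dp' dy' dr := by
  have h1 : ∀ j, dp j ^ 2 ≤ dp' j ^ 2 := fun j => sq_le_sq.2 ((hp j).trans (le_abs_self _))
  have h2 : ∀ i j, dy i j ^ 2 ≤ dy' i j ^ 2 := fun i j =>
    sq_le_sq.2 ((hy i j).trans (le_abs_self _))
  refine add_le_add_left (add_le_add (mul_le_mul_of_nonneg_left ?_ (by positivity))
    (mul_le_mul_of_nonneg_left ?_ (by positivity))) _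
  · exact Finset.sum_le_sum fun j _ => h1 j
  · exact Finset.sum_le_sum fun i _ => Finset.sum_le_sum fun j _ => h2 i j

lemma exists_gap_rate (h : M.IsADMM β p x y) (hM : M.IsClassical) (hβ : 0 < β) (R : ℝ) :
    ∃ C : ℝ, ∀ K : ℕ, 1 ≤ K → ∀ z ∈ M.allocations, (∀ i j, z i j ≤ R) →
      ∀ q : Fin m → ℝ, (∀ j, |q j| ≤ R) →
      M.lagrangian z (average p K) - M.lagrangian (average x K) q ≤ C / K := by
  -- This dominates the initial distance to every `(q, z)` in the box of size `R`.
  refine ⟨energy n β (fun j => R + |p 0 j|) (fun i j => R + |y 0 i j|) (M.excess (y 0)),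
    fun K hK z hz hzR q hq => (h.gap_average_le hM hβ hK hz q).trans ?_⟩
  refine div_le_div_of_nonneg_right (energy_le_energy hβ _ (fun j => ?_) fun i j => ?_)
    (Nat.cast_nonneg K)
  · exact (abs_sub _ _).trans (by linarith [hq j])
  · refine (abs_sub _ _).trans ?_
    rw [abs_of_nonneg ((hz i).1 j)]
    linarith [hzR i j]

lemma exists_iterate_rate (h : M.IsADMM β p x y) (hM : M.IsClassical) (hβ : 0 < β)
    {q : Fin m → ℝ} {z : Fin n → Fin m → ℝ} (hs : M.IsSaddlePoint q z) :
    ∃ C : ℝ, ∀ k : ℕ, 1 ≤ k → (∀ j, (p k j - p (k - 1) j) ^ 2 ≤ C / k) ∧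
      (∀ j, (∑ i, x k i j - M.capacity j) ^ 2 ≤ C / k) := by
  obtain ⟨D, hD⟩ : ∃ D, D = 2 * β * M.lyapunov β p y z q 0 := ⟨_, rfl⟩
  have hD0 : 0 ≤ D := hD ▸ mul_nonneg (by positivity) (lyapunov_nonneg p y z q 0 hβ)
  have hstep : ∀ k j, (p (k + 1) j - p k j) ^ 2 ≤ D / ((k + 1 : ℕ) : ℝ) := by
    intro k j
    refine (sq_price_step_le (M := M) p y k hβ j).trans ?_
    rw [hD, mul_div_assoc]
    exact mul_le_mul_of_nonneg_left (h.stepEnergy_le_div hM hβ hs k) (by positivity)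
  refine ⟨D + ((n + 1) / β) ^ 2 * D, fun k hk => ?_⟩
  obtain ⟨k, rfl⟩ : ∃ l, k = l + 1 := ⟨k - 1, by omega⟩
  have h1 : 0 ≤ ((n + 1) / β) ^ 2 * D := by positivity
  refine ⟨fun j => ?_, fun j => ?_⟩
  · refine (hstep k j).trans ?_
    gcongr
    linarith
  · have e : ∑ i, x (k + 1) i j - M.capacity j = (n + 1) / β * (p (k + 1) j - p k j) := by
      rw [h.demand_excess_eq hβ, h.price_succ]
      field_simp
      ring
    rw [e, mul_pow]
    refine (mul_le_mul_of_nonneg_left (hstep k j) (sq_nonneg _)).trans ?_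
    rw [← mul_div_assoc]
    gcongr
    linarith

end IsADMM

/-! ### The dual objective -/

lemma tendsto_average_price {p : ℕ → Fin m → ℝ} {q : Fin m → ℝ} (hp : Tendsto p atTop (𝓝 q)) :
    Tendsto (average p) atTop (𝓝 q) :=
  (((tendsto_add_atTop_iff_nat 1).2 hp).cesaro_smul).congr fun K => (average_eq p K).symm

/-- At positive prices, bundles using the whole budget dominate all others in the Lagrangian. -/
lemma IsClassical.exists_bounded_lagrangian_le (hM : M.IsClassical) {p : Fin m → ℝ}
    (hp : ∀ j, 0 < p j) {z : Fin n → Fin m → ℝ} (hz : z ∈ M.allocations) :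
    ∃ z' ∈ M.allocations, (∀ i j, z' i j ≤ M.budget i / p j) ∧
      M.lagrangian z p ≤ M.lagrangian z' p := by
  have hc : ∀ i, 0 < cost p (z i) := by
    intro i
    have hnn : ∀ j ∈ Finset.univ, 0 ≤ p j * z i j := fun j _ =>
      mul_nonneg (hp j).le ((hz i).1 j)
    refine (Finset.sum_nonneg hnn).lt_of_ne fun h0 => ?_
    have hzero : z i = 0 := by
      funext j
      have := (Finset.sum_eq_zero_iff_of_nonneg hnn).1 h0.symm j (Finset.mem_univ j)
      exact (mul_eq_zero.1 this).resolve_left (hp j).ne'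
    have := (hz i).2
    rw [hzero, hM.utility_zero] at this
    exact this.false
  have hcost : ∀ i, cost p ((M.budget i / cost p (z i)) • z i) = M.budget i := fun i => by
    rw [cost_smul, div_mul_cancel₀ _ (hc i).ne']
  have hmem : ∀ i, (M.budget i / cost p (z i)) • z i ∈ M.logDomain i := fun i =>
    hM.smul_mem_logDomain (hz i) (div_pos (hM.budget_pos i) (hc i))
  refine ⟨fun i => (M.budget i / cost p (z i)) • z i, hmem, fun i j => ?_, ?_⟩
  · rw [le_div_iff₀ (hp j), mul_comm]
    refine le_of_le_of_eq ?_ (hcost i)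
    exact Finset.single_le_sum (f := fun j => p j * ((M.budget i / cost p (z i)) • z i) j)
      (fun j _ => mul_nonneg (hp j).le ((hmem i).1 j)) (Finset.mem_univ j)
  · simp only [lagrangian, sum_mul_sum_sub_capacity, welfare, hcost]
    have := Finset.sum_le_sum fun i (_ : i ∈ Finset.univ) => hM.agent_le_scaled (hz i) (hc i)
    simp only [Finset.sum_sub_distrib] at this
    linarith

/-- The gap rate is uniform only on bounded sets, while the dual objective is a supremum over
unbounded allocations. Average prices eventually exceed `q j / 2`, so this supremum may be
restricted to budget-exhausting bundles in a fixed box; the radius given to `exists_gap_rate` covers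
that box and `q`. -/
lemma IsADMM.exists_dual_rate {p : ℕ → Fin m → ℝ} {x y : ℕ → Fin n → Fin m → ℝ}
    (h : M.IsADMM β p x y) (hM : M.IsClassical) (hβ : 0 < β)
    {q : Fin m → ℝ} {z : Fin n → Fin m → ℝ} (hs : M.IsSaddlePoint q z)
    (hp : Tendsto p atTop (𝓝 q)) (hq : ∀ j, 0 < q j) : ∃ C : ℝ, ∀ᶠ K : ℕ in atTop,
      M.dualObjective (average p K) ≤ M.dualObjective q + ((C / K : ℝ) : EReal) := by
  have hnn : ∀ i j, 0 ≤ M.budget i / (q j / 2) := fun i j =>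
    div_nonneg (hM.budget_pos i).le (half_pos (hq j)).le
  have hS₁ : 0 ≤ ∑ i, ∑ j, M.budget i / (q j / 2) :=
    Finset.sum_nonneg fun i _ => Finset.sum_nonneg fun j _ => hnn i j
  have hS₂ : 0 ≤ ∑ j, |q j| := Finset.sum_nonneg fun j _ => abs_nonneg _
  obtain ⟨C, hC⟩ := h.exists_gap_rate hM hβ (∑ i, ∑ j, M.budget i / (q j / 2) + ∑ j, |q j|)
  refine ⟨C, ?_⟩
  have hev : ∀ᶠ K in atTop, ∀ j, q j / 2 < average p K j := eventually_all.2 fun j =>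
    (tendsto_pi_nhds.1 (tendsto_average_price hp) j).eventually_const_lt (half_lt_self (hq j))
  filter_upwards [hev, eventually_ge_atTop 1] with K hK hK1
  refine iSup₂_le fun v hv => ?_
  obtain ⟨v', hv', hbd, hle⟩ := hM.exists_bounded_lagrangian_le
    (fun j => (half_pos (hq j)).trans (hK j)) hv
  have h1 : M.lagrangian v' (average p K) - M.lagrangian (average x K) q ≤ C / K := by
    refine hC K hK1 v' hv' (fun i j => ?_) q fun j => ?_
    · have h2 : M.budget i / average p K j ≤ M.budget i / (q j / 2) :=
        div_le_div_of_nonneg_left (hM.budget_pos i).le (half_pos (hq j)) (hK j).le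
      have h3 : M.budget i / (q j / 2) ≤ ∑ j, M.budget i / (q j / 2) :=
        Finset.single_le_sum (f := fun j => M.budget i / (q j / 2)) (fun j _ => hnn i j)
          (Finset.mem_univ j)
      have h4 : ∑ j, M.budget i / (q j / 2) ≤ ∑ i, ∑ j, M.budget i / (q j / 2) :=
        Finset.single_le_sum (f := fun i => ∑ j, M.budget i / (q j / 2))
          (fun i _ => Finset.sum_nonneg fun j _ => hnn i j) (Finset.mem_univ i)
      linarith [hbd i j]
    · have : |q j| ≤ ∑ j, |q j| := Finset.single_le_sum (f := fun j => |q j|)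
        (fun j _ => abs_nonneg _) (Finset.mem_univ j)
      linarith
  have h2 := hs.lagrangian_le _ (h.average_mem hM hK1)
  have h3 : M.lagrangian v (average p K) ≤ M.lagrangian z q + C / K := by linarith
  calc ((M.lagrangian v (average p K) : ℝ) : EReal)
      ≤ ((M.lagrangian z q + C / K : ℝ) : EReal) := EReal.coe_le_coe_iff.2 h3
    _ = (M.lagrangian z q : EReal) + ((C / K : ℝ) : EReal) := EReal.coe_add _ _
    _ ≤ _ := add_le_add_left (le_iSup₂ (f := fun x (_ : x ∈ M.allocations) =>
        ((M.lagrangian x q : ℝ) : EReal)) z hs.mem) _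

end FisherMarket

theorem mainTheorem3 {n m : ℕ} (hn : 0 < n) (M : FisherMarket n m) (hM : M.IsClassical)
    (β : ℝ) (hβ : 0 < β) :
    -- the algorithm is well defined for all initial prices and baseline demands
    (∀ (p₀ : Fin m → ℝ) (y₀ : Fin n → Fin m → ℝ),
      (∃ p x y, M.IsADMM β p x y ∧ p 0 = p₀ ∧ y 0 = y₀) ∧
      ∀ p x y p' x' y', M.IsADMM β p x y → p 0 = p₀ → y 0 = y₀ →
        M.IsADMM β p' x' y' → p' 0 = p₀ → y' 0 = y₀ →
        p = p' ∧ y = y' ∧ ∀ k, x (k + 1) = x' (k + 1)) ∧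
    -- equilibrium prices exist
    ((∀ j, 0 < M.capacity j) → (∀ i, ∀ z ∈ FisherMarket.orthant m, 0 ≤ M.utility i z) →
      ∃ p, M.IsEquilibriumPrice p) ∧
    -- the algorithm converges to an equilibrium, with rate `O(1 / k)`
    ((∃ p, M.IsEquilibriumPrice p) →
      ∀ (p : ℕ → Fin m → ℝ) (x y : ℕ → Fin n → Fin m → ℝ), M.IsADMM β p x y →
        ∃ (pstar : Fin m → ℝ) (xstar : Fin n → Fin m → ℝ),
          M.IsEquilibrium pstar xstar ∧
          Tendsto p atTop (𝓝 pstar) ∧ Tendsto x atTop (𝓝 xstar) ∧ Tendsto y atTop (𝓝 xstar) ∧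
          -- average excess demand and welfare gap
          (∃ C : ℝ, ∀ K : ℕ, 1 ≤ K →
            (∀ j, |∑ i, FisherMarket.average x K i j - M.capacity j| ≤ C / K) ∧
            |M.welfare (FisherMarket.average x K) - M.welfare xstar| ≤ C / K) ∧
          -- primal-dual gap, uniformly on bounded sets of allocations and prices
          (∀ R : ℝ, ∃ C : ℝ, ∀ K : ℕ, 1 ≤ K → ∀ z ∈ M.allocations, (∀ i j, z i j ≤ R) →
            ∀ q : Fin m → ℝ, (∀ j, |q j| ≤ R) →
            M.lagrangian z (FisherMarket.average p K) - M.lagrangian (FisherMarket.average x K) q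
              ≤ C / K) ∧
          -- dual gap of the average prices
          ((∀ j, 0 < pstar j) → ∃ C : ℝ, ∀ᶠ K : ℕ in atTop,
            M.dualObjective (FisherMarket.average p K)
              ≤ M.dualObjective pstar + ((C / K : ℝ) : EReal)) ∧
          -- squared price change and squared excess demand of the iterates themselves
          (∃ C : ℝ, ∀ k : ℕ, 1 ≤ k →
            (∀ j, (p k j - p (k - 1) j) ^ 2 ≤ C / k) ∧
            (∀ j, (∑ i, x k i j - M.capacity j) ^ 2 ≤ C / k))) := by
  refine ⟨fun p₀ y₀ => ⟨hM.exists_isADMM hβ p₀ y₀, ?_⟩, fun hs hu => ?_, ?_⟩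
  · rintro p x y p' x' y' h hp hy h' hp' hy'
    exact hM.isADMM_unique hβ h h' (hp.trans hp'.symm) (hy.trans hy'.symm)
  · obtain ⟨p, x, h⟩ := hM.exists_isSaddlePoint hn hs hu
    exact ⟨p, x, h.isEquilibrium hM⟩
  · rintro ⟨q, z, hq⟩ p x y h
    obtain ⟨pstar, xstar, hs, hp, hx, hy⟩ :=
      h.exists_tendsto_isSaddlePoint hM hβ (hq.isSaddlePoint hM)
    exact ⟨pstar, xstar, hs.isEquilibrium hM, hp, hx, hy,
      h.exists_feasibility_welfare_rate hM hβ hs hp, h.exists_gap_rate hM hβ,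
      h.exists_dual_rate hM hβ hs hp, h.exists_iterate_rate hM hβ hs⟩
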